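/- **Theorem 3.1 (Generalized Montel Theorem).** Let $M$ be an $n$-dimensional smooth manifold (without boundary, Hausdorff, second countable) equipped with a smooth positive density $\mathrm{vol}$, let $E\to M$ and $F\to M$ be smooth real vector bundles of finite rank, and let $L:C^\infty(M,E)\to C^\infty(M,F)$ be a linear differential operator of finite order with smooth coefficients. For an open set $\Omega\subset M$ let $\mathcal D(\Omega,E^*)$ be the space of smooth sections of $E^*$ with compact support in $\Omega$, and let $\mathcal D'(\Omega,E)$ be the space of distributional sections of $E$ over $\Omega$, i.e. of continuous linear functionals $u:\mathcal D(\Omega,E^*)\to\mathbb R$, $\phi\mapsto u[\phi]$. For $u\in\mathcal D'(\Omega,E)$ the equation $Lu=0$ means that $u[L^*\phi]=0$ for all $\phi\in\mathcal D(\Omega,F^*)$, where $L^*$ is the formally dual operator, characterized by $\int_M\langle Lv,\phi\rangle\,\mathrm{vol}=\int_M\langle v,L^*\phi\rangle\,\mathrm{vol}$ for all $v\in C^\infty(M,E)$. Suppose that $L$ is weakly hypoelliptic: for every open $\Omega\subset M$, every $u\in\mathcal D'(\Omega,E)$ with $Lu=0$ is smooth, i.e. of the form $u[\phi]=\int_\Omega\langle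 s,\phi\rangle\,\mathrm{vol}$ for a smooth section $s$ of $E$ over $\Omega$. Let $u_1,u_2,\ldots\in C^\infty(M,E)$ be a sequence of solutions of $Lu_j=0$ that is locally $L^1$-bounded, i.e. $\sup_j\int_K|u_j|\,\mathrm{vol}<\infty$ for every compact $K\subset M$, where $|\cdot|$ is the fibre norm of a Riemannian metric on $E$. Then there are a subsequence $(u_{j_i})_i$ and a section $u\in C^\infty(M,E)$ with $Lu=0$ such that $u_{j_i}\to u$ in the $C^\infty$-topology, i.e. in local charts and local trivializations all derivatives of all orders converge uniformly on compact sets. -/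

import Mathlib

open Set Filter Topology MeasureTheory Bundle Manifold
open scoped ContDiff

namespace Montel

noncomputable section

/-- The Euclidean model space `ℝⁿ`. -/
abbrev Model (n : ℕ) : Type := EuclideanSpace ℝ (Fin n)

section Sections

variable {n : ℕ} {M : Type*} [TopologicalSpace M] [ChartedSpace (Model n) M]
  (F : Type*) [NormedAddCommGroup F] [NormedSpace ℝ F]
  (V : M → Type*) [TopologicalSpace (TotalSpace F V)]
  [∀ x, AddCommGroup (V x)] [∀ x, Module ℝ (V x)] [∀ x, TopologicalSpace (V x)]
  [FiberBundle F V] [VectorBundle ℝ F V]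

/-- `C^∞(M, V)`: the smooth sections of the vector bundle `V → M` with typical fibre `F`. -/
abbrev Smooth : Type _ := ContMDiffSection (𝓡 n) F ∞ V

/-- The dual bundle `V* → M`, with typical fibre `F →L[ℝ] ℝ`. -/
abbrev Dual (V : M → Type*) [∀ x, AddCommGroup (V x)] [∀ x, Module ℝ (V x)]
    [∀ x, TopologicalSpace (V x)] : M → Type _ :=
  fun x => V x →L[ℝ] Bundle.Trivial M ℝ x

variable {F V}

/-- The expression of a section `s` in a chart `e` of `M` and a local trivialization `t` of the
bundle.  It is only meaningful on the open set `e '' (e.source ∩ t.baseSet)` of `ℝⁿ`. -/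
def localRep (e : OpenPartialHomeomorph M (Model n))
    (t : Trivialization F (TotalSpace.proj : TotalSpace F V → M)) (s : ∀ x, V x) :
    Model n → F :=
  fun y => (t ⟨e.symm y, s (e.symm y)⟩).2

/-- Convergence in the `C^∞`-topology: in all smooth charts and all local trivializations, all
derivatives (of every order `j ≥ 0`) converge uniformly on compact sets. -/
def CInftyTendsto (u : ℕ → Smooth (n := n) F V) (w : Smooth (n := n) F V) : Prop :=
  ∀ e ∈ IsManifold.maximalAtlas (𝓡 n) ∞ M,
  ∀ (t : Trivialization F (TotalSpace.proj : TotalSpace F V → M)) [MemTrivializationAtlas t],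
  ∀ K : Set M, IsCompact K → K ⊆ e.source ∩ t.baseSet → ∀ j : ℕ,
    TendstoUniformlyOn (fun ν => iteratedFDeriv ℝ j (localRep e t (u ν)))
      (iteratedFDeriv ℝ j (localRep e t w)) atTop (e '' K)

/-- The support of a section. -/
def supp (s : ∀ x, V x) : Set M := closure {x | s x ≠ 0}

variable (F V) in
/-- `𝒟(Ω, V)`: smooth sections with compact support contained in the open set `Ω ⊆ M`
(extended by zero to all of `M`). -/
def TestSection (Ω : TopologicalSpace.Opens M) : Submodule ℝ (Smooth (n := n) F V) where
  carrier := {φ | IsCompact (supp φ) ∧ supp φ ⊆ Ω}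
  zero_mem' := by simp [supp]
  add_mem' := by
    intro a b ha hb
    have h : supp (a + b : Smooth (n := n) F V) ⊆ supp a ∪ supp b := by
      unfold supp
      rw [← closure_union]
      refine closure_mono fun x hx => ?_
      by_contra hcon
      simp only [mem_union, mem_ofPred_eq, not_or, not_not] at hcon
      exact hx (by simp [hcon.1, hcon.2])
    exact ⟨(ha.1.union hb.1).of_isClosed_subset isClosed_closure h,
      h.trans (union_subset ha.2 hb.2)⟩
  smul_mem' := by
    intro c a ha
    have h : supp (c • a : Smooth (n := n) F V) ⊆ supp a := by
      refine closure_mono fun x hx hcon => ?_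
      exact hx (by simp [hcon])
    exact ⟨ha.1.of_isClosed_subset isClosed_closure h, h.trans ha.2⟩

/-- Convergence in `𝒟(Ω, V)`: the supports stay in one compact subset of `Ω`, and there is
convergence in the `C^∞`-topology. -/
def TestTendsto {Ω : TopologicalSpace.Opens M} (φ : ℕ → TestSection (n := n) F V Ω)
    (φ₀ : TestSection (n := n) F V Ω) : Prop :=
  (∃ K : Set M, IsCompact K ∧ K ⊆ Ω ∧ ∀ ν, supp (φ ν : Smooth (n := n) F V) ⊆ K) ∧
    CInftyTendsto (fun ν => (φ ν : Smooth (n := n) F V)) φ₀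

end Sections

section Operators

variable {n : ℕ} {M : Type*} [TopologicalSpace M] [ChartedSpace (Model n) M]
  {F : Type*} [NormedAddCommGroup F] [NormedSpace ℝ F]
  {V : M → Type*} [TopologicalSpace (TotalSpace F V)]
  [∀ x, AddCommGroup (V x)] [∀ x, Module ℝ (V x)] [∀ x, TopologicalSpace (V x)]
  [FiberBundle F V] [VectorBundle ℝ F V]
  {G : Type*} [NormedAddCommGroup G] [NormedSpace ℝ G]
  {W : M → Type*} [TopologicalSpace (TotalSpace G W)]
  [∀ x, AddCommGroup (W x)] [∀ x, Module ℝ (W x)] [∀ x, TopologicalSpace (W x)]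
  [FiberBundle G W] [VectorBundle ℝ G W]

/-- `L : C^∞(M, V) → C^∞(M, W)` is a linear differential operator of order (at most) `k`: in the
charts and local trivializations around each point it has the form
`(L u)(y) = ∑_{j ≤ k} a_j(y) (D^j u (y))`, with smooth coefficients `a_j` whose values are linear
maps on `j`-linear maps; this is the usual form `∑_{|α| ≤ k} a_α(y) (∂^α u)(y)` with smooth
matrices `a_α`. -/
def IsDifferentialOperator (k : ℕ) (L : Smooth (n := n) F V →ₗ[ℝ] Smooth (n := n) G W) : Prop :=
  ∀ x₀ : M,
    let e := chartAt (Model n) x₀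
    let t := trivializationAt F V x₀
    let t' := trivializationAt G W x₀
    let U := e.source ∩ t.baseSet ∩ t'.baseSet
    ∃ a : (j : ℕ) → Model n → ((Model n [×j]→L[ℝ] F) →L[ℝ] G),
      (∀ j ≤ k, ContDiffOn ℝ ∞ (a j) (e '' U)) ∧
      ∀ u : Smooth (n := n) F V, ∀ y ∈ e '' U,
        localRep e t' (L u) y =
          ∑ j ∈ Finset.range (k + 1), a j y (iteratedFDeriv ℝ j (localRep e t u) y)

end Operators

section Measures

variable {n : ℕ} {M : Type*} [TopologicalSpace M] [ChartedSpace (Model n) M] [MeasurableSpace M]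

/-- The measure `vol` is given by a smooth positive density: in the charts around each point it
is `ρ(y) dy` with `ρ` smooth and positive. -/
def IsSmoothPositiveDensity (n : ℕ) [ChartedSpace (Model n) M] (vol : Measure M) : Prop :=
  ∀ x₀ : M,
    let e := chartAt (Model n) x₀
    ∃ ρ : Model n → ℝ, ContDiffOn ℝ ∞ ρ e.target ∧ (∀ y ∈ e.target, 0 < ρ y) ∧
      ∀ A : Set M, MeasurableSet A → A ⊆ e.source →
        vol A = ∫⁻ y in e '' A, ENNReal.ofReal (ρ y)

end Measures

section Distributions

variable {n : ℕ} {M : Type*} [TopologicalSpace M] [ChartedSpace (Model n) M] [MeasurableSpace M]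
  {F : Type*} [NormedAddCommGroup F] [NormedSpace ℝ F]
  {V : M → Type*} [TopologicalSpace (TotalSpace F V)]
  [∀ x, AddCommGroup (V x)] [∀ x, Module ℝ (V x)] [∀ x, TopologicalSpace (V x)]
  [FiberBundle F V] [VectorBundle ℝ F V]
  {G : Type*} [NormedAddCommGroup G] [NormedSpace ℝ G]
  {W : M → Type*} [TopologicalSpace (TotalSpace G W)]
  [∀ x, AddCommGroup (W x)] [∀ x, Module ℝ (W x)] [∀ x, TopologicalSpace (W x)]
  [FiberBundle G W] [VectorBundle ℝ G W]

variable (n F V) in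
/-- `𝒟'(Ω, V)`: distributional sections of `V` over `Ω`, i.e. linear functionals on the space
`𝒟(Ω, V*)` of test sections of the dual bundle that are continuous with respect to the
convergence of test sections. -/
structure DistSection (Ω : TopologicalSpace.Opens M) where
  /-- the evaluation `φ ↦ u[φ]` -/
  toLin : TestSection (n := n) (F →L[ℝ] ℝ) (Dual V) Ω →ₗ[ℝ] ℝ
  continuous' : ∀ (φ : ℕ → TestSection (n := n) (F →L[ℝ] ℝ) (Dual V) Ω)
    (φ₀ : TestSection (n := n) (F →L[ℝ] ℝ) (Dual V) Ω),
    TestTendsto φ φ₀ → Tendsto (fun ν => toLin (φ ν)) atTop (𝓝 (toLin φ₀))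

/-- A distributional section `u ∈ 𝒟'(Ω, V)` is smooth if it is of the form
`u[φ] = ∫_Ω ⟨s, φ⟩ vol` for a smooth section `s` of `V` over `Ω` (the values of `s` outside `Ω`
are irrelevant, since `φ` vanishes there). -/
def DistSection.IsSmooth (vol : Measure M) {Ω : TopologicalSpace.Opens M}
    (u : DistSection n F V Ω) : Prop :=
  ∃ s : ∀ x, V x,
    ContMDiffOn (𝓡 n) ((𝓡 n).prod 𝓘(ℝ, F)) ∞ (fun x => TotalSpace.mk' F x (s x)) (Ω : Set M) ∧
    ∀ φ : TestSection (n := n) (F →L[ℝ] ℝ) (Dual V) Ω,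
      u.toLin φ = ∫ x, (φ : Smooth (n := n) (F →L[ℝ] ℝ) (Dual V)) x (s x) ∂vol

/-- `ψ = L* φ`, for `φ` and `ψ` sections of the dual bundles `W*` and `V*`, where `L*` is the
formally dual operator of `L`: `∫ ⟨L v, φ⟩ vol = ∫ ⟨v, ψ⟩ vol` for all `v ∈ C^∞(M, V)`.
This is used for compactly supported `φ`, `ψ`.  For `φ ∈ 𝒟(Ω, W*)` there is exactly one such
`ψ ∈ 𝒟(Ω, V*)` (integrate by parts in local coordinates). -/
def IsFormalDualOf (vol : Measure M) (L : Smooth (n := n) F V →ₗ[ℝ] Smooth (n := n) G W)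
    (φ : Smooth (n := n) (G →L[ℝ] ℝ) (Dual W)) (ψ : Smooth (n := n) (F →L[ℝ] ℝ) (Dual V)) :
    Prop :=
  ∀ v : Smooth (n := n) F V, ∫ x, φ x (L v x) ∂vol = ∫ x, ψ x (v x) ∂vol

/-- `L u = 0` in `𝒟'(Ω, W)`, where `(L u)[φ] := u[L* φ]` for `φ ∈ 𝒟(Ω, W*)`. -/
def DistSection.Solves (vol : Measure M) (L : Smooth (n := n) F V →ₗ[ℝ] Smooth (n := n) G W)
    {Ω : TopologicalSpace.Opens M} (u : DistSection n F V Ω) : Prop :=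
  ∀ (φ : TestSection (n := n) (G →L[ℝ] ℝ) (Dual W) Ω)
    (ψ : TestSection (n := n) (F →L[ℝ] ℝ) (Dual V) Ω),
    IsFormalDualOf vol L φ ψ → u.toLin ψ = 0

/-- `L` is weakly hypoelliptic: over every open `Ω ⊆ M`, every distributional section `u` of `V`
with `L u = 0` is smooth. -/
def IsWeaklyHypoelliptic (vol : Measure M)
    (L : Smooth (n := n) F V →ₗ[ℝ] Smooth (n := n) G W) : Prop :=
  ∀ (Ω : TopologicalSpace.Opens M) (u : DistSection n F V Ω), u.Solves vol L → u.IsSmooth vol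

/-- Local `L¹`-boundedness of a sequence of sections of `V`, with respect to the fibre norm
`|v| = √(g(v, v))` of a Riemannian metric `g` on `V`: for each compact `K ⊆ M`,
`sup_j ∫_K |u_j| vol < ∞`. -/
def LocallyL1Bounded (vol : Measure M) (g : ContMDiffRiemannianMetric (𝓡 n) ∞ F V)
    (u : ℕ → Smooth (n := n) F V) : Prop :=
  ∀ K : Set M, IsCompact K →
    (⨆ j, ∫⁻ x in K, ENNReal.ofReal √(g.inner x (u j x) (u j x)) ∂vol) < ⊤

end Distributions

end

end Montel

/-! The core is an a priori estimate: a locally `L¹`-bounded sequence of solutions has all its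
derivatives bounded on compact sets. Weak hypoellipticity is only a qualitative assumption, and the
uniform boundedness principle turns it into this estimate. For `c ∈ ℓ¹` the `L¹` bounds make `∑ c_ν
u_ν` a distribution. Each term is annihilated by `L`, so the sum is too, and hence it is given by a
smooth section `s c` (`IsWeaklyHypoelliptic.exists_smooth_series`).

Testing against bump functions that shrink to a point shows that `s c` at that point is a pointwise
limit of continuous linear functionals of `c`. By Banach–Steinhaus it is then continuous and linear
in `c` (`LocallyL1Bounded.exists_clm_series`). Difference quotients carry this over to every
derivative. A second use of Banach–Steinhaus, over the points of a compact set, bounds the `j`-th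
derivative of `s c` there by `C * ‖c‖`. The unit vectors of `ℓ¹` have norm one and give back the
`u_ν` themselves (`series_single`), so `C` bounds the whole sequence.

The rest is Arzelà–Ascoli: Tychonoff gives a subsequence that converges on a countable dense set,
and the derivative bounds upgrade this to `C^∞`-convergence (`exists_subseq_cInftyTendsto`). The
limit is again a solution, because in local coordinates `L` is a finite sum of continuous linear
maps of derivatives. -/

namespace Montel

/-! ### Smooth functions depending linearly on a Banach space parameter -/

section BanachCalculus

variable {X E F : Type*} [NormedAddCommGroup X] [NormedSpace ℝ X] [CompleteSpace X]
  [NormedAddCommGroup E] [NormedSpace ℝ E] [NormedAddCommGroup F] [NormedSpace ℝ F]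

/-- A pointwise limit of continuous linear maps on a Banach space is continuous linear. -/
theorem exists_clm_of_tendsto {T : ℕ → X →L[ℝ] F} {f : X → F}
    (h : ∀ c, Tendsto (fun m => T m c) atTop (𝓝 (f c))) : ∃ S : X →L[ℝ] F, ∀ c, S c = f c :=
  ⟨continuousLinearMapOfTendsto T (tendsto_pi_nhds.2 h), fun _ => rfl⟩

theorem differentiableAt_iteratedFDeriv_of_contDiffOn {f : E → F} {O : Set E} (hO : IsOpen O)
    (hf : ContDiffOn ℝ ∞ f O) (j : ℕ) {y : E} (hy : y ∈ O) :
    DifferentiableAt ℝ (iteratedFDeriv ℝ j f) y :=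
  (hf.contDiffAt (hO.mem_nhds hy)).differentiableAt_iteratedFDeriv
    (by exact_mod_cast ENat.natCast_lt_top j)

theorem continuousOn_iteratedFDeriv_of_contDiffOn {f : E → F} {O : Set E} (hO : IsOpen O)
    (hf : ContDiffOn ℝ ∞ f O) (j : ℕ) : ContinuousOn (iteratedFDeriv ℝ j f) O :=
  fun _ hy => (differentiableAt_iteratedFDeriv_of_contDiffOn hO hf j hy).continuousAt.continuousWithinAt

/-- If a family of smooth functions `f c` depends, pointwise, continuously and linearly on the
parameter `c` in a Banach space, then so do all its derivatives. -/
theorem exists_clm_iteratedFDeriv_apply {f : X → E → F} {O : Set E} (hO : IsOpen O)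
    (hf : ∀ c, ContDiffOn ℝ ∞ (f c) O) (hlin : ∀ y ∈ O, ∃ T : X →L[ℝ] F, ∀ c, T c = f c y)
    (j : ℕ) : ∀ y ∈ O, ∀ v : Fin j → E,
      ∃ T : X →L[ℝ] F, ∀ c, T c = iteratedFDeriv ℝ j (f c) y v := by
  induction j with
  | zero => intro y hy v; simpa using hlin y hy
  | succ j ih =>
    intro y hy v
    -- The next derivative is a limit of difference quotients with step `1 / (m + 1)`, each
    -- continuous and linear in `c` by induction.
    have hdiff : ∀ c, Tendsto (fun m : ℕ => ((m : ℝ) + 1) •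
        (iteratedFDeriv ℝ j (f c) (y + ((m : ℝ) + 1)⁻¹ • v 0) (Fin.tail v) -
          iteratedFDeriv ℝ j (f c) y (Fin.tail v))) atTop
        (𝓝 (iteratedFDeriv ℝ (j + 1) (f c) y v)) := by
      intro c
      have h1 := (differentiableAt_iteratedFDeriv_of_contDiffOn hO (hf c) j hy).hasFDerivAt
      have hc : Tendsto (fun m : ℕ => ‖(m : ℝ) + 1‖) atTop atTop :=
        tendsto_norm_atTop_atTop.comp
          (tendsto_atTop_add_const_right _ _ tendsto_natCast_atTop_atTop)
      have h2 := h1.lim (v 0) hc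
      have h3 := ((ContinuousMultilinearMap.apply ℝ (fun _ : Fin j => E) F
        (Fin.tail v)).continuous.tendsto _).comp h2
      simpa [Function.comp_def, iteratedFDeriv_succ_apply_left] using h3
    have hnear : ∀ᶠ m : ℕ in atTop, y + ((m : ℝ) + 1)⁻¹ • v 0 ∈ O := by
      have h0 : Tendsto (fun m : ℕ => y + ((m : ℝ) + 1)⁻¹ • v 0) atTop
          (𝓝 (y + (0 : ℝ) • v 0)) := by
        refine tendsto_const_nhds.add (Tendsto.smul_const ?_ _)
        simpa [one_div] using tendsto_one_div_add_atTop_nhds_zero_nat (𝕜 := ℝ)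
      exact h0.eventually (hO.mem_nhds (by simpa using hy))
    -- The induction hypothesis holds only inside `O`, so the sequence is shifted by `N` to keep all
    -- its points there.
    obtain ⟨N, hN⟩ := eventually_atTop.1 hnear
    choose T hT using fun m : ℕ => ih _ (hN (m + N) (by omega)) (Fin.tail v)
    obtain ⟨T₀, hT₀⟩ := ih y hy (Fin.tail v)
    refine exists_clm_of_tendsto (T := fun m => (((m + N : ℕ) : ℝ) + 1) • (T m - T₀)) fun c => ?_
    simpa [hT, hT₀] using (tendsto_add_atTop_iff_nat N).2 (hdiff c)

/-- In the situation of `exists_clm_iteratedFDeriv_apply`, the derivatives are bounded on compact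
sets, uniformly for bounded parameters. -/
theorem exists_norm_iteratedFDeriv_le {f : X → E → F} {O : Set E} (hO : IsOpen O)
    (hf : ∀ c, ContDiffOn ℝ ∞ (f c) O) (hlin : ∀ y ∈ O, ∃ T : X →L[ℝ] F, ∀ c, T c = f c y)
    (j : ℕ) {K : Set E} (hK : IsCompact K) (hKO : K ⊆ O) :
    ∃ C, ∀ c, ∀ y ∈ K, ‖iteratedFDeriv ℝ j (f c) y‖ ≤ C * ‖c‖ := by
  choose T hT using exists_clm_iteratedFDeriv_apply hO hf hlin j
  -- Banach–Steinhaus is applied to the family indexed by points of `K` and direction tuples,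
  -- normalized by `∏ ‖v l‖`. If that product is zero, its inverse is zero as well and the operator
  -- vanishes.
  have hbdd : ∀ c, ∃ C, ∀ i : K × (Fin j → E),
      ‖((∏ l, ‖i.2 l‖)⁻¹ • T i.1 (hKO i.1.2) i.2) c‖ ≤ C := by
    intro c
    obtain ⟨C, hC⟩ := hK.exists_bound_of_continuousOn
      ((continuousOn_iteratedFDeriv_of_contDiffOn hO (hf c) j).mono hKO)
    refine ⟨C, fun ⟨y, v⟩ => ?_⟩
    have h0 : 0 ≤ ∏ l, ‖v l‖ := Finset.prod_nonneg fun _ _ => norm_nonneg _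
    have hC0 : 0 ≤ C := (norm_nonneg _).trans (hC y y.2)
    simp only [_root_.smul_apply, norm_smul, norm_inv, Real.norm_of_nonneg h0, hT]
    rcases h0.eq_or_lt with h | h
    · simp [← h, hC0]
    · rw [inv_mul_le_iff₀ h, mul_comm]
      exact (ContinuousMultilinearMap.le_opNorm _ _).trans (by gcongr; exact hC y y.2)
  obtain ⟨C, hC⟩ := banach_steinhaus hbdd
  refine ⟨max C 0, fun c y hy => ContinuousMultilinearMap.opNorm_le_bound (by positivity)
    fun v => ?_⟩
  have h0 : 0 ≤ ∏ l, ‖v l‖ := Finset.prod_nonneg fun _ _ => norm_nonneg _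
  rcases h0.eq_or_lt with h | h
  · rw [← h, mul_zero]
    exact (ContinuousMultilinearMap.le_opNorm _ _).trans (by simp [← h])
  · have h1 := ((((∏ l, ‖v l‖)⁻¹ • T y (hKO hy) v).le_opNorm c)).trans
      (mul_le_mul_of_nonneg_right ((hC (⟨y, hy⟩, v)).trans (le_max_left C 0)) (norm_nonneg c))
    simp only [_root_.smul_apply, norm_smul, norm_inv, Real.norm_of_nonneg h0,
      hT, inv_mul_le_iff₀ h] at h1
    rwa [mul_comm]

end BanachCalculus

/-! ### Equicontinuity, interpolation and `C^∞` limits -/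

section Compactness

variable {E F : Type*} [NormedAddCommGroup E] [NormedSpace ℝ E]
  [NormedAddCommGroup F] [NormedSpace ℝ F]

/-- Interpolation: the derivative is controlled by the function and by a Lipschitz constant of
the derivative. -/
theorem norm_fderiv_le_of_lipschitz {h : E → F} {y : E} {t η B : ℝ} (ht : 0 < t)
    (hd : ∀ z ∈ Metric.closedBall y t, DifferentiableAt ℝ h z)
    (hη : ∀ z ∈ Metric.closedBall y t, ‖h z‖ ≤ η) (hB : 0 ≤ B)
    (hlip : ∀ z ∈ Metric.closedBall y t, ‖fderiv ℝ h z - fderiv ℝ h y‖ ≤ B * t) :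
    ‖fderiv ℝ h y‖ ≤ 2 * η / t + B * t := by
  have hy : y ∈ Metric.closedBall y t := Metric.mem_closedBall_self ht.le
  have hη0 : 0 ≤ η := (norm_nonneg _).trans (hη y hy)
  refine ContinuousLinearMap.opNorm_le_of_unit_norm (by positivity) fun v hv => ?_
  have hz : y + t • v ∈ Metric.closedBall y t := by
    simp [norm_smul, hv, abs_of_pos ht]
  have h1 := (convex_closedBall y t).norm_image_sub_le_of_norm_hasFDerivWithin_le'
    (fun z hz => (hd z hz).hasFDerivAt.hasFDerivWithinAt) hlip hy hz
  have h2 : t • fderiv ℝ h y v = (h (y + t • v) - h y) -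
      (h (y + t • v) - h y - fderiv ℝ h y (y + t • v - y)) := by simp
  have h3 : t * ‖fderiv ℝ h y v‖ ≤ (η + η) + B * t * t := by
    calc t * ‖fderiv ℝ h y v‖ = ‖t • fderiv ℝ h y v‖ := by rw [norm_smul, Real.norm_of_nonneg ht.le]
      _ ≤ ‖h (y + t • v) - h y‖ + ‖h (y + t • v) - h y - fderiv ℝ h y (y + t • v - y)‖ := by
        rw [h2]; exact norm_sub_le _ _
      _ ≤ (η + η) + B * t * t := by
        refine add_le_add ((norm_sub_le _ _).trans (add_le_add (hη _ hz) (hη _ hy))) (h1.trans ?_)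
        simp [norm_smul, hv, abs_of_pos ht]
  rw [show 2 * η / t + B * t = ((η + η) + B * t * t) / t by field_simp; ring, le_div_iff₀ ht]
  linarith

/-- Every point of `O` has a ball on which the sequence is uniformly Cauchy. -/
def LocallyUniformCauchy (h : ℕ → E → F) (O : Set E) : Prop :=
  ∀ x ∈ O, ∃ r > 0, UniformCauchySeqOn h atTop (Metric.ball x r)

variable [ProperSpace E]

/-- On a ball with compact closure in `O` the functions share a Lipschitz constant, so being Cauchy
at finitely many points of `D` near a `δ`-net suffices. -/
theorem locallyUniformCauchy_of_dense {h : ℕ → E → F} {O D : Set E} (hO : IsOpen O)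
    (hd : ∀ ν, ∀ y ∈ O, DifferentiableAt ℝ (h ν) y)
    (hbdd : ∀ K ⊆ O, IsCompact K → ∃ C, ∀ ν, ∀ y ∈ K, ‖fderiv ℝ (h ν) y‖ ≤ C)
    (hD : O ⊆ closure D) (hDc : ∀ d ∈ D ∩ O, CauchySeq fun ν => h ν d) :
    LocallyUniformCauchy h O := by
  intro x hx
  obtain ⟨r, hr, hrO⟩ := Metric.nhds_basis_closedBall.mem_iff.1 (hO.mem_nhds hx)
  obtain ⟨C₀, hC₀⟩ := hbdd _ hrO (isCompact_closedBall x r)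
  set C := max C₀ 0
  have hC : ∀ ν, ∀ y ∈ Metric.ball x r, ‖fderiv ℝ (h ν) y‖ ≤ C := fun ν y hy =>
    (hC₀ ν y (Metric.ball_subset_closedBall hy)).trans (le_max_left _ _)
  have hC0 : 0 ≤ C := le_max_right _ _
  have hbO : Metric.ball x r ⊆ O := Metric.ball_subset_closedBall.trans hrO
  have hlip : ∀ ν, ∀ y ∈ Metric.ball x r, ∀ z ∈ Metric.ball x r,
      dist (h ν y) (h ν z) ≤ C * dist y z := fun ν y hy z hz => by
    rw [dist_eq_norm, dist_eq_norm]
    exact (convex_ball x r).norm_image_sub_le_of_norm_fderiv_le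
      (fun w hw => hd ν w (hbO hw)) (hC ν) hz hy
  refine ⟨r, hr, Metric.uniformCauchySeqOn_iff.2 fun ε hε => ?_⟩
  -- A point of `D` is found within `2 * δ`. The two Lipschitz errors then total at most `4 * C *
  -- δ`, leaving `ε / 4` for the Cauchy estimate.
  set δ := ε / (8 * (C + 1))
  have hδ : 0 < δ := by positivity
  have hδε : 4 * C * δ < ε / 2 + ε / 4 := by
    have : 8 * (C + 1) * δ = ε := by simp only [δ]; field_simp
    nlinarith
  obtain ⟨t, htb, htf, htc⟩ := Metric.finite_approx_of_totallyBounded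
    ((isCompact_closedBall x r).totallyBounded.subset Metric.ball_subset_closedBall) δ hδ
  have hex : ∀ p ∈ t, ∃ d ∈ D, d ∈ Metric.ball x r ∧ dist p d < δ := fun p hp => by
    obtain ⟨d, ⟨hd1, hd2⟩, hd3⟩ := mem_closure_iff.1 (hD (hbO (htb hp)))
      (Metric.ball x r ∩ Metric.ball p δ) (Metric.isOpen_ball.inter Metric.isOpen_ball)
      ⟨htb hp, Metric.mem_ball_self hδ⟩
    exact ⟨d, hd3, hd1, by rwa [dist_comm]⟩
  choose! d hdD hdb hdp using hex
  have hev : ∀ p ∈ t, ∃ N, ∀ m ≥ N, ∀ n ≥ N, dist (h m (d p)) (h n (d p)) < ε / 4 := fun p hp =>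
    Metric.cauchySeq_iff.1 (hDc _ ⟨hdD p hp, hbO (hdb p hp)⟩) _ (by positivity)
  choose! N hN using hev
  obtain ⟨N₀, hN₀⟩ := (htf.image N).bddAbove
  refine ⟨N₀, fun m hm n hn y hy => ?_⟩
  obtain ⟨p, hp, hyp⟩ := mem_iUnion₂.1 (htc hy)
  have hNp : N p ≤ N₀ := hN₀ (mem_image_of_mem _ hp)
  have hyd : dist y (d p) ≤ 2 * δ := by
    have := dist_triangle y p (d p)
    have h1 := hdp p hp
    have h2 : dist y p < δ := hyp
    linarith
  have h1 := hlip m y hy _ (hdb p hp)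
  have h2 := hlip n y hy _ (hdb p hp)
  have h3 := hN p hp m (hNp.trans hm) n (hNp.trans hn)
  have h4 := dist_triangle4 (h m y) (h m (d p)) (h n (d p)) (h n y)
  rw [dist_comm (h n (d p))] at h4
  have h5 := mul_le_mul_of_nonneg_left hyd hC0
  linarith

/-- Interpolation applied to `h m - h n`: small values and bounded second derivatives force small
first derivatives. -/
theorem LocallyUniformCauchy.fderiv {h : ℕ → E → F} {O : Set E} (hO : IsOpen O)
    (hc : LocallyUniformCauchy h O)
    (hd : ∀ ν, ∀ y ∈ O, DifferentiableAt ℝ (h ν) y)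
    (hd₂ : ∀ ν, ∀ y ∈ O, DifferentiableAt ℝ (fderiv ℝ (h ν)) y)
    (hbdd : ∀ K ⊆ O, IsCompact K → ∃ C, ∀ ν, ∀ y ∈ K, ‖fderiv ℝ (fderiv ℝ (h ν)) y‖ ≤ C) :
    LocallyUniformCauchy (fun ν => fderiv ℝ (h ν)) O := by
  intro x hx
  obtain ⟨r₁, hr₁, hr₁O⟩ := Metric.nhds_basis_closedBall.mem_iff.1 (hO.mem_nhds hx)
  obtain ⟨r₂, hr₂, hcau⟩ := hc x hx
  obtain ⟨C₀, hC₀⟩ := hbdd _ hr₁O (isCompact_closedBall x r₁)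
  set C := max C₀ 0
  set r := min r₁ r₂
  have hr : 0 < r := lt_min hr₁ hr₂
  have hC0 : 0 ≤ C := le_max_right _ _
  have hb₁ : Metric.ball x r ⊆ Metric.closedBall x r₁ :=
    (Metric.ball_subset_ball (min_le_left _ _)).trans Metric.ball_subset_closedBall
  have hbO : Metric.ball x r ⊆ O := hb₁.trans hr₁O
  have hC : ∀ ν, ∀ y ∈ Metric.ball x r, ‖_root_.fderiv ℝ (_root_.fderiv ℝ (h ν)) y‖ ≤ C :=
    fun ν y hy => (hC₀ ν y (hb₁ hy)).trans (le_max_left _ _)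
  have hlip : ∀ ν, ∀ y ∈ Metric.ball x r, ∀ z ∈ Metric.ball x r,
      ‖_root_.fderiv ℝ (h ν) z - _root_.fderiv ℝ (h ν) y‖ ≤ C * ‖z - y‖ := fun ν y hy z hz =>
    (convex_ball x r).norm_image_sub_le_of_norm_fderiv_le
      (fun w hw => hd₂ ν w (hbO hw)) (hC ν) hy hz
  refine ⟨r / 2, by positivity, Metric.uniformCauchySeqOn_iff.2 fun ε hε => ?_⟩
  -- The bound `t < r / 2` keeps the balls of radius `t` inside the larger ball. With `η = ε * t /
  -- 8` the interpolation bound `2 * η / t + 2 * C * t` is below `ε / 4 + ε / 2`.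
  obtain ⟨t, ht0, htr, htC⟩ : ∃ t > 0, t < r / 2 ∧ 2 * C * t < ε / 2 := by
    refine ⟨min (r / 4) (ε / (4 * (C + 1)) / 2), by positivity,
      (min_le_left _ _).trans_lt (by linarith), ?_⟩
    have h1 : min (r / 4) (ε / (4 * (C + 1)) / 2) ≤ ε / (4 * (C + 1)) / 2 := min_le_right _ _
    have h2 : 4 * (C + 1) * (ε / (4 * (C + 1))) = ε := by field_simp
    have h3 : 0 < ε / (4 * (C + 1)) := by positivity
    nlinarith
  obtain ⟨N, hN⟩ := Metric.uniformCauchySeqOn_iff.1 hcau (ε * t / 8) (by positivity)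
  refine ⟨N, fun m hm n hn y hy => ?_⟩
  have hsub : Metric.closedBall y t ⊆ Metric.ball x r := by
    refine Metric.closedBall_subset_ball' ?_
    have : dist y x < r / 2 := hy
    linarith
  have hfd : ∀ z ∈ Metric.closedBall y t, _root_.fderiv ℝ (h m - h n) z =
      _root_.fderiv ℝ (h m) z - _root_.fderiv ℝ (h n) z := fun z hz =>
    fderiv_sub (hd m z (hbO (hsub hz))) (hd n z (hbO (hsub hz)))
  have hyy := Metric.mem_closedBall_self (x := y) ht0.le
  have key := norm_fderiv_le_of_lipschitz (h := h m - h n) (y := y) (η := ε * t / 8)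
    (B := 2 * C) ht0
    (fun z hz => (hd m z (hbO (hsub hz))).sub (hd n z (hbO (hsub hz))))
    (fun z hz => by
      rw [Pi.sub_apply, ← dist_eq_norm]
      exact (hN m hm n hn z (Metric.ball_subset_ball (min_le_right _ _) (hsub hz))).le)
    (by positivity)
    (fun z hz => by
      rw [hfd z hz, hfd y hyy, sub_sub_sub_comm]
      have h1 := hlip m y (hsub hyy) z (hsub hz)
      have h2 := hlip n y (hsub hyy) z (hsub hz)
      have h3 : ‖z - y‖ ≤ t := by rw [← dist_eq_norm]; exact hz
      have h4 := mul_le_mul_of_nonneg_left h3 hC0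
      exact (norm_sub_le _ _).trans (by linarith))
  rw [hfd y hyy] at key
  rw [dist_eq_norm]
  have : 2 * (ε * t / 8) / t = ε / 4 := by field_simp; norm_num
  rw [this] at key
  linarith

/-- `LocallyUniformCauchy.fderiv` for a derivative that is expressed through an isometry. -/
theorem LocallyUniformCauchy.of_fderiv_eq_comp {F' : Type*} [NormedAddCommGroup F']
    [NormedSpace ℝ F'] (I : F' ≃ₗᵢ[ℝ] (E →L[ℝ] F)) {h : ℕ → E → F} {k : ℕ → E → F'} {O : Set E}
    (hO : IsOpen O) (hc : LocallyUniformCauchy h O)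
    (hd : ∀ ν, ∀ y ∈ O, DifferentiableAt ℝ (h ν) y) (hk : ∀ ν, _root_.fderiv ℝ (h ν) = I ∘ k ν)
    (hdk : ∀ ν, ∀ y ∈ O, DifferentiableAt ℝ (k ν) y)
    (hbdd : ∀ K ⊆ O, IsCompact K → ∃ C, ∀ ν, ∀ y ∈ K, ‖_root_.fderiv ℝ (k ν) y‖ ≤ C) :
    LocallyUniformCauchy k O := by
  have h1 := hc.fderiv hO hd
    (fun ν y hy => by
      rw [hk]
      exact I.toContinuousLinearEquiv.differentiableAt.comp y (hdk ν y hy))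
    (fun K hK hKc => by
      obtain ⟨C, hC⟩ := hbdd K hK hKc
      refine ⟨C, fun ν y hy => ?_⟩
      have h2 := I.comp_fderiv (f := k ν) (x := y)
      rw [hk, h2]
      refine (ContinuousLinearMap.opNorm_le_bound _ (norm_nonneg _) fun v => ?_).trans (hC ν y hy)
      simpa using ContinuousLinearMap.le_opNorm _ v)
  intro x hx
  obtain ⟨r, hr, h⟩ := h1 x hx
  refine ⟨r, hr, ?_⟩
  have h2 := I.symm.isometry.uniformContinuous.comp_uniformCauchySeqOn h
  simpa [hk, Function.comp_def] using h2

/-- Induction on `j`: the first derivative bound and the dense set start it, and each passage from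
order `j` to `j + 1` uses the bound of order `j + 2`. -/
theorem locallyUniformCauchy_iteratedFDeriv {f : ℕ → E → F} {O D : Set E} (hO : IsOpen O)
    (hf : ∀ ν, ContDiffOn ℝ ∞ (f ν) O)
    (hbdd : ∀ j : ℕ, ∀ K ⊆ O, IsCompact K → ∃ C, ∀ ν, ∀ y ∈ K, ‖iteratedFDeriv ℝ j (f ν) y‖ ≤ C)
    (hD : O ⊆ closure D) (hDc : ∀ d ∈ D ∩ O, CauchySeq fun ν => f ν d) (j : ℕ) :
    LocallyUniformCauchy (fun ν => iteratedFDeriv ℝ j (f ν)) O := by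
  have hd := fun j ν y hy =>
    differentiableAt_iteratedFDeriv_of_contDiffOn (y := y) hO (hf ν) j hy
  have hsucc : ∀ j ν, fderiv ℝ (iteratedFDeriv ℝ j (f ν)) =
      (continuousMultilinearCurryLeftEquiv ℝ (fun _ : Fin (j + 1) => E) F) ∘
        iteratedFDeriv ℝ (j + 1) (f ν) := fun j ν => fderiv_iteratedFDeriv
  induction j with
  | zero =>
    have h0 : LocallyUniformCauchy f O := locallyUniformCauchy_of_dense hO
      (fun ν y hy => ((hf ν).contDiffAt (hO.mem_nhds hy)).differentiableAt (by simp))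
      (fun K hK hKc => by simpa [norm_iteratedFDeriv_one] using hbdd 1 K hK hKc) hD hDc
    intro x hx
    obtain ⟨r, hr, h⟩ := h0 x hx
    refine ⟨r, hr, ?_⟩
    simp only [iteratedFDeriv_zero_eq_comp]
    exact (continuousMultilinearCurryFin0 ℝ E F).symm.isometry.uniformContinuous.comp_uniformCauchySeqOn h
  | succ j ih =>
    refine ih.of_fderiv_eq_comp (continuousMultilinearCurryLeftEquiv ℝ (fun _ : Fin (j + 1) => E) F)
      hO (hd j) (hsucc j) (hd (j + 1)) fun K hK hKc => ?_
    simpa only [norm_fderiv_iteratedFDeriv] using hbdd (j + 2) K hK hKc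

variable [CompleteSpace F]

/-- A sequence of smooth functions with locally bounded derivatives of all orders that converges
pointwise converges in the `C^∞`-topology. -/
theorem contDiffOn_and_tendsto_of_bounded {f : ℕ → E → F} {g : E → F} {O : Set E} (hO : IsOpen O)
    (hf : ∀ ν, ContDiffOn ℝ ∞ (f ν) O)
    (hbdd : ∀ j : ℕ, ∀ K ⊆ O, IsCompact K → ∃ C, ∀ ν, ∀ y ∈ K, ‖iteratedFDeriv ℝ j (f ν) y‖ ≤ C)
    (hg : ∀ y ∈ O, Tendsto (fun ν => f ν y) atTop (𝓝 (g y))) :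
    ContDiffOn ℝ ∞ g O ∧ ∀ (j : ℕ) (K : Set E), K ⊆ O → IsCompact K →
      TendstoUniformlyOn (fun ν => iteratedFDeriv ℝ j (f ν)) (iteratedFDeriv ℝ j g) atTop K := by
  have hc := locallyUniformCauchy_iteratedFDeriv hO hf hbdd subset_closure
    fun d hd => (hg d hd.1).cauchySeq
  have hlim : ∀ j, ∀ y ∈ O, ∃ a, Tendsto (fun ν => iteratedFDeriv ℝ j (f ν) y) atTop (𝓝 a) :=
    fun j y hy => by
      obtain ⟨r, hr, h⟩ := hc j y hy
      exact cauchySeq_tendsto_of_complete (h.cauchy_map (Metric.mem_ball_self hr))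
  choose! p hp using hlim
  have hloc : ∀ j, TendstoLocallyUniformlyOn (fun ν => iteratedFDeriv ℝ j (f ν)) (p j) atTop O := by
    refine fun j => tendstoLocallyUniformlyOn_of_forall_exists_nhds fun x hx => ?_
    obtain ⟨r, hr, h⟩ := hc j x hx
    refine ⟨Metric.ball x r ∩ O, Filter.inter_mem (mem_nhdsWithin_of_mem_nhds (Metric.ball_mem_nhds x hr))
      self_mem_nhdsWithin, ?_⟩
    exact (h.mono inter_subset_left).tendstoUniformlyOn_of_tendsto fun y hy => hp j y hy.2
  -- Locally uniform convergence of the derivatives allows differentiating the limit, so the limits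
  -- `p j` form a Taylor series of `g`.
  have htaylor : HasFTaylorSeriesUpToOn ∞ g (fun y j => p j y) O := by
    refine ⟨fun y hy => ?_, fun m _ y hy => ?_, fun m _ => ?_⟩
    · have h1 := ((continuousMultilinearCurryFin0 ℝ E F).continuous.tendsto _).comp (hp 0 y hy)
      exact tendsto_nhds_unique h1 (by simpa [Function.comp_def] using hg y hy)
    · refine (hasFDerivAt_of_tendstoLocallyUniformlyOn (f := fun ν => iteratedFDeriv ℝ m (f ν))
        (f' := fun ν => fderiv ℝ (iteratedFDeriv ℝ m (f ν)))
        (g' := fun y => (p (m + 1) y).curryLeft) hO ?_ (fun ν z hz =>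
          (differentiableAt_iteratedFDeriv_of_contDiffOn hO (hf ν) m hz).hasFDerivAt)
        (hp m) hy).hasFDerivWithinAt
      have h1 := (continuousMultilinearCurryLeftEquiv ℝ (fun _ : Fin (m + 1) => E)
        F).isometry.uniformContinuous.comp_tendstoLocallyUniformlyOn (hloc (m + 1))
      simp only [fderiv_iteratedFDeriv]
      exact h1
    · exact (hloc m).continuousOn (Eventually.frequently (Eventually.of_forall fun ν =>
        continuousOn_iteratedFDeriv_of_contDiffOn hO (hf ν) m))
  have hcd : ContDiffOn ℝ ∞ g O := htaylor.contDiffOn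
  refine ⟨hcd, fun j K hKO hK => ?_⟩
  have heq : EqOn (p j) (iteratedFDeriv ℝ j g) K := fun y hy => by
    rw [← iteratedFDerivWithin_of_isOpen j hO (hKO hy)]
    exact htaylor.eq_iteratedFDerivWithin_of_uniqueDiffOn (by exact_mod_cast le_top)
      hO.uniqueDiffOn (hKO hy)
  exact ((tendstoLocallyUniformlyOn_iff_forall_isCompact hO).1 (hloc j) K hKO hK).congr_right heq

end Compactness

/-! ### Local expressions of smooth sections -/

section LocalRep

variable {n : ℕ} {M : Type*} [TopologicalSpace M] [ChartedSpace (Model n) M]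
  {F : Type*} [NormedAddCommGroup F] [NormedSpace ℝ F]
  {V : M → Type*} [TopologicalSpace (TotalSpace F V)]
  [∀ x, AddCommGroup (V x)] [∀ x, Module ℝ (V x)] [∀ x, TopologicalSpace (V x)]
  [FiberBundle F V] [VectorBundle ℝ F V]

theorem isOpen_image_source_inter_baseSet (e : OpenPartialHomeomorph M (Model n))
    (t : Trivialization F (TotalSpace.proj : TotalSpace F V → M)) :
    IsOpen (e '' (e.source ∩ t.baseSet)) :=
  e.isOpen_image_source_inter t.open_baseSet

theorem localRep_apply_of_mem {e : OpenPartialHomeomorph M (Model n)}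
    (t : Trivialization F (TotalSpace.proj : TotalSpace F V → M)) (s : ∀ x, V x) {x : M}
    (hx : x ∈ e.source) : localRep e t s (e x) = (t ⟨x, s x⟩).2 := by
  rw [localRep, e.left_inv hx]

variable [IsManifold (𝓡 n) ∞ M] [ContMDiffVectorBundle ∞ F V (𝓡 n)]

/-- Smooth sections have smooth local expressions. -/
theorem contDiffOn_localRep {e : OpenPartialHomeomorph M (Model n)}
    (he : e ∈ IsManifold.maximalAtlas (𝓡 n) ∞ M)
    (t : Trivialization F (TotalSpace.proj : TotalSpace F V → M)) [MemTrivializationAtlas t]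
    (s : Smooth (n := n) F V) :
    ContDiffOn ℝ ∞ (localRep e t s) (e '' (e.source ∩ t.baseSet)) := by
  have h1 : ContMDiffOn (𝓡 n) 𝓘(ℝ, F) ∞ (fun x => (t ⟨x, s x⟩).2) t.baseSet :=
    (t.contMDiffOn_section_baseSet_iff).1 s.contMDiff.contMDiffOn
  have h2 : ContMDiffOn 𝓘(ℝ, Model n) (𝓡 n) ∞ e.symm e.target :=
    contMDiffOn_symm_of_mem_maximalAtlas he
  rw [← contMDiffOn_iff_contDiffOn]
  refine h1.comp (h2.mono ?_) ?_
  · rintro _ ⟨x, hx, rfl⟩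
    exact e.map_source hx.1
  · rintro _ ⟨x, hx, rfl⟩
    simpa [e.left_inv hx.1] using hx.2

/-- A section with smooth local expressions around each point is smooth. -/
theorem contMDiff_of_contDiffOn_localRep (s : ∀ x, V x)
    (h : ∀ x₀, ContDiffOn ℝ ∞ (localRep (chartAt (Model n) x₀) (trivializationAt F V x₀) s)
      (chartAt (Model n) x₀ '' ((chartAt (Model n) x₀).source ∩ (trivializationAt F V x₀).baseSet))) :
    ContMDiff (𝓡 n) ((𝓡 n).prod 𝓘(ℝ, F)) ∞ fun x => TotalSpace.mk' F x (s x) := by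
  intro x₀
  set e := chartAt (Model n) x₀
  set t := trivializationAt F V x₀
  have hxe : x₀ ∈ e.source := mem_chart_source _ _
  have hxt : x₀ ∈ t.baseSet := mem_baseSet_trivializationAt F V x₀
  rw [contMDiffAt_section]
  have h1 : ContMDiffAt 𝓘(ℝ, Model n) 𝓘(ℝ, F) ∞ (localRep e t s) (e x₀) :=
    contMDiffAt_iff_contDiffAt.2 ((h x₀).contDiffAt
      ((isOpen_image_source_inter_baseSet e t).mem_nhds (mem_image_of_mem _ ⟨hxe, hxt⟩)))
  have h2 : ContMDiffAt (𝓡 n) 𝓘(ℝ, Model n) ∞ e x₀ :=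
    contMDiffAt_of_mem_maximalAtlas (IsManifold.chart_mem_maximalAtlas x₀) hxe
  refine (h1.comp x₀ h2).congr_of_eventuallyEq ?_
  filter_upwards [e.open_source.mem_nhds hxe] with x hx
  exact (localRep_apply_of_mem t s hx).symm

end LocalRep

/-! ### Measures given by smooth positive densities -/

section Density

variable {n : ℕ} {M : Type*} [TopologicalSpace M] [ChartedSpace (Model n) M] [MeasurableSpace M]
  [BorelSpace M] {vol : Measure M}

/-- The density is bounded on a closed ball in the chart target. This makes pairings with test
sections integrable. -/
theorem IsSmoothPositiveDensity.isLocallyFiniteMeasure (h : IsSmoothPositiveDensity n vol) :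
    IsLocallyFiniteMeasure vol := by
  refine ⟨fun x => ?_⟩
  obtain ⟨ρ, hρ, -, hvol⟩ := h x
  set e := chartAt (Model n) x
  have hxe : x ∈ e.source := mem_chart_source _ _
  obtain ⟨r, hr, hrt⟩ := Metric.nhds_basis_closedBall.mem_iff.1
    (e.open_target.mem_nhds (e.map_source hxe))
  obtain ⟨C, hC⟩ := (isCompact_closedBall (e x) r).exists_bound_of_continuousOn
    (hρ.continuousOn.mono hrt)
  have hA : IsOpen (e.source ∩ e ⁻¹' Metric.ball (e x) r) := e.isOpen_inter_preimage Metric.isOpen_ball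
  refine ⟨_, hA.mem_nhds ⟨hxe, Metric.mem_ball_self hr⟩, ?_⟩
  rw [hvol _ hA.measurableSet inter_subset_left]
  have hsub : e '' (e.source ∩ e ⁻¹' Metric.ball (e x) r) ⊆ Metric.closedBall (e x) r := by
    rintro _ ⟨y, hy, rfl⟩
    exact Metric.ball_subset_closedBall hy.2
  calc _ ≤ ∫⁻ y in Metric.closedBall (e x) r, ENNReal.ofReal (ρ y) := lintegral_mono_set hsub
    _ ≤ ∫⁻ _ in Metric.closedBall (e x) r, ENNReal.ofReal C :=
      setLIntegral_mono' measurableSet_closedBall fun y hy =>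
        ENNReal.ofReal_le_ofReal ((Real.le_norm_self _).trans (hC y hy))
    _ < ⊤ := by
      rw [setLIntegral_const]
      exact ENNReal.mul_lt_top ENNReal.ofReal_lt_top
        (isCompact_closedBall (e x) r).measure_lt_top

/-- Near a point the density exceeds half its value there. Positivity on open sets is what allows
bump functions to be normalized to integral one. -/
theorem IsSmoothPositiveDensity.isOpenPosMeasure (h : IsSmoothPositiveDensity n vol) :
    vol.IsOpenPosMeasure := by
  refine ⟨fun U hU ⟨x, hx⟩ => ?_⟩
  obtain ⟨ρ, hρ, hpos, hvol⟩ := h x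
  set e := chartAt (Model n) x
  have hxe : x ∈ e.source := mem_chart_source _ _
  have hxt := e.map_source hxe
  have hB : IsOpen (e.target ∩ ρ ⁻¹' Ioi (ρ (e x) / 2)) :=
    hρ.continuousOn.isOpen_inter_preimage e.open_target isOpen_Ioi
  set A := U ∩ (e.source ∩ e ⁻¹' (e.target ∩ ρ ⁻¹' Ioi (ρ (e x) / 2)))
  have hA : IsOpen A := hU.inter (e.isOpen_inter_preimage hB)
  have hAe : A ⊆ e.source := fun y hy => hy.2.1
  have hxA : x ∈ A := ⟨hx, hxe, hxt, by simpa using hpos _ hxt⟩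
  have hio : IsOpen (e '' A) := e.isOpen_image_of_subset_source hA hAe
  refine ne_of_gt (lt_of_lt_of_le ?_ (measure_mono (inter_subset_left : A ⊆ U)))
  rw [hvol A hA.measurableSet hAe]
  calc 0 < ENNReal.ofReal (ρ (e x) / 2) * volume (e '' A) :=
        ENNReal.mul_pos (by simpa using hpos _ hxt)
          (hio.measure_pos volume ⟨e x, mem_image_of_mem _ hxA⟩).ne'
    _ = ∫⁻ _ in e '' A, ENNReal.ofReal (ρ (e x) / 2) := (setLIntegral_const _ _).symm
    _ ≤ _ := setLIntegral_mono' hio.measurableSet (by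
      rintro _ ⟨y, hy, rfl⟩
      exact ENNReal.ofReal_le_ofReal (le_of_lt hy.2.2.2))

end Density

/-! ### The dual bundle and the fibre norm in trivializations -/

section DualBundle

variable {n : ℕ} {M : Type*} [TopologicalSpace M] [ChartedSpace (Model n) M]
  {F : Type*} [NormedAddCommGroup F] [NormedSpace ℝ F]
  {V : M → Type*} [TopologicalSpace (TotalSpace F V)]
  [∀ x, AddCommGroup (V x)] [∀ x, Module ℝ (V x)] [∀ x, TopologicalSpace (V x)]
  [FiberBundle F V] [VectorBundle ℝ F V]

theorem mem_baseSet_trivializationAt_dual {x₀ x : M} (hx : x ∈ (trivializationAt F V x₀).baseSet) :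
    x ∈ (trivializationAt (F →L[ℝ] ℝ) (Dual V) x₀).baseSet := by
  rw [hom_trivializationAt_baseSet]
  exact ⟨hx, mem_univ _⟩

theorem trivializationAt_dual_apply {x₀ x : M} (hx : x ∈ (trivializationAt F V x₀).baseSet)
    (ξ : Dual V x) (w : F) :
    (trivializationAt (F →L[ℝ] ℝ) (Dual V) x₀ ⟨x, ξ⟩).2 w =
      ξ ((trivializationAt F V x₀).symm x w) := by
  rw [hom_trivializationAt_apply]
  simp [ContinuousLinearMap.inCoordinates, Trivialization.symmL_apply _ hx]

/-- Reduces fibrewise pairings to evaluation on the fixed space `F`, where continuity and operator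
norms are available. -/
theorem dual_apply_eq {x₀ x : M} (hx : x ∈ (trivializationAt F V x₀).baseSet)
    (ξ : Dual V x) (v : V x) :
    ξ v = (trivializationAt (F →L[ℝ] ℝ) (Dual V) x₀ ⟨x, ξ⟩).2
      (trivializationAt F V x₀ ⟨x, v⟩).2 := by
  rw [trivializationAt_dual_apply hx, Trivialization.symm_apply_apply_mk _ hx]

/-- The pairing of two continuous sections is continuous. -/
theorem continuous_dual_apply {φ : ∀ x, Dual V x} {s : ∀ x, V x}
    (hφ : Continuous fun x => TotalSpace.mk' (F →L[ℝ] ℝ) x (φ x))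
    (hs : Continuous fun x => TotalSpace.mk' F x (s x)) : Continuous fun x => φ x (s x) := by
  refine continuous_iff_continuousAt.2 fun x₀ => ?_
  have h1 := ((FiberBundle.continuousAt_totalSpace _ _).1 (hφ.continuousAt (x := x₀))).2
  have h2 := ((FiberBundle.continuousAt_totalSpace _ _).1 (hs.continuousAt (x := x₀))).2
  refine (h1.clm_apply h2).congr ?_
  filter_upwards [(trivializationAt F V x₀).open_baseSet.mem_nhds
    (mem_baseSet_trivializationAt F V x₀)] with x hx
  exact (dual_apply_eq hx _ _).symm

variable [∀ x, IsTopologicalAddGroup (V x)] [∀ x, ContinuousSMul ℝ (V x)]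

/-- Only this inequality between the two norms is needed: it bounds a pairing `ξ v` by the norm of
`ξ` in the trivialization times the fibre norm of `v`. -/
theorem eventually_norm_trivializationAt_le_sqrt (g : ContMDiffRiemannianMetric (𝓡 n) ∞ F V)
    (x₀ : M) : ∃ C > 0, ∀ᶠ x in 𝓝 x₀, ∀ v : V x,
      ‖(trivializationAt F V x₀ ⟨x, v⟩).2‖ ≤ C * √(g.inner x v v) := by
  let _ : RiemannianBundle V := ⟨g.toContinuousRiemannianMetric.toRiemannianMetric⟩
  obtain ⟨C, hC, h⟩ := eventually_norm_trivializationAt_lt F V x₀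
  refine ⟨C, hC, ?_⟩
  filter_upwards [h, (trivializationAt F V x₀).open_baseSet.mem_nhds
    (mem_baseSet_trivializationAt F V x₀)] with x hx hxb v
  have h1 := ((trivializationAt F V x₀).continuousLinearMapAt ℝ x).le_of_opNorm_le hx.le v
  have h2 : ‖v‖ = √(g.inner x v v) := by
    rw [norm_eq_sqrt_real_inner]; rfl
  rwa [h2, Trivialization.continuousLinearMapAt_apply, Trivialization.linearMapAt_apply,
    if_pos hxb] at h1

end DualBundle

/-! ### Test sections and approximate point evaluations -/

section TestSections

variable {n : ℕ} {M : Type*} [TopologicalSpace M] [ChartedSpace (Model n) M]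
  {F : Type*} [NormedAddCommGroup F] [NormedSpace ℝ F]
  {V : M → Type*} [TopologicalSpace (TotalSpace F V)]
  [∀ x, AddCommGroup (V x)] [∀ x, Module ℝ (V x)] [∀ x, TopologicalSpace (V x)]
  [FiberBundle F V] [VectorBundle ℝ F V]

theorem eq_zero_of_notMem_supp {s : ∀ x, V x} {x : M} (hx : x ∉ supp s) : s x = 0 := by
  by_contra h
  exact hx (subset_closure h)

theorem integrable_dual_apply [MeasurableSpace M] [OpensMeasurableSpace M] (vol : Measure M)
    [IsFiniteMeasureOnCompacts vol] {Ω : TopologicalSpace.Opens M}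
    (φ : TestSection (n := n) (F →L[ℝ] ℝ) (Dual V) Ω) (s : Smooth (n := n) F V) :
    Integrable (fun x => (φ : Smooth (n := n) (F →L[ℝ] ℝ) (Dual V)) x (s x)) vol := by
  refine (continuous_dual_apply (φ : Smooth (n := n) (F →L[ℝ] ℝ) (Dual V)).contMDiff.continuous
    s.contMDiff.continuous).integrable_of_hasCompactSupport ?_
  refine φ.2.1.of_isClosed_subset isClosed_closure (closure_mono fun x hx h => hx ?_)
  simp only [h]
  rfl

variable [T2Space M] [IsManifold (𝓡 n) ∞ M] [ContMDiffVectorBundle ∞ F V (𝓡 n)]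
  [∀ x, IsTopologicalAddGroup (V x)] [∀ x, ContinuousSMul ℝ (V x)]

/-- A bump function times a covector, constant in a local trivialization, is a test section. -/
theorem exists_testSection_bump (x₀ : M) (lam : F →L[ℝ] ℝ) (b : SmoothBumpFunction (𝓡 n) x₀)
    (hb : tsupport b ⊆ (trivializationAt F V x₀).baseSet) :
    ∃ φ : TestSection (n := n) (F →L[ℝ] ℝ) (Dual V) ⊤, ∀ x (v : V x),
      (φ : Smooth (n := n) (F →L[ℝ] ℝ) (Dual V)) x v =
        b x * lam (trivializationAt F V x₀ ⟨x, v⟩).2 := by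
  set t := trivializationAt F V x₀
  let σ : ∀ x, Dual V x := fun x => lam.comp (t.continuousLinearMapAt ℝ x)
  have hσ : ContMDiffOn (𝓡 n) ((𝓡 n).prod 𝓘(ℝ, F →L[ℝ] ℝ)) ∞
      (fun x => TotalSpace.mk' (F →L[ℝ] ℝ) x (σ x)) t.baseSet := by
    rw [(trivializationAt (F →L[ℝ] ℝ) (Dual V) x₀).contMDiffOn_section_iff t.open_baseSet
      fun x hx => mem_baseSet_trivializationAt_dual hx]
    refine (contMDiffOn_const (c := lam)).congr fun x hx => ?_
    ext w
    rw [trivializationAt_dual_apply hx]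
    simp only [σ, ContinuousLinearMap.comp_apply, t.continuousLinearMapAt_apply ℝ,
      t.coe_linearMapAt_of_mem hx]
    exact congrArg (fun p : M × F => lam p.2) (t.apply_mk_symm hx w)
  have hs := ContMDiffOn.smul_section_of_tsupport (u := t.baseSet) (ψ := b) (s := σ)
    b.contMDiff.contMDiffOn t.open_baseSet hb hσ
  refine ⟨⟨⟨fun x => b x • σ x, hs⟩, ?_, fun _ _ => trivial⟩, fun x v => ?_⟩
  · refine b.hasCompactSupport.of_isClosed_subset isClosed_closure
      (closure_mono fun x hx h => hx ?_)
    simp [h]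
  · change b x * lam (t.continuousLinearMapAt ℝ x v) = _
    by_cases hx : x ∈ t.baseSet
    · rw [t.continuousLinearMapAt_apply ℝ, t.coe_linearMapAt_of_mem hx]
    · rw [image_eq_zero_of_notMem_tsupport fun h => hx (hb h), zero_mul, zero_mul]

/-- There are sequences of test sections of the dual bundle that converge to any given covector
at a given point, as functionals on smooth sections. -/
theorem exists_testSection_tendsto [SecondCountableTopology M] [MeasurableSpace M] [BorelSpace M]
    (vol : Measure M) [IsFiniteMeasureOnCompacts vol] [vol.IsOpenPosMeasure]
    (x₀ : M) (lam : F →L[ℝ] ℝ) :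
    ∃ φ : ℕ → TestSection (n := n) (F →L[ℝ] ℝ) (Dual V) ⊤, ∀ s : Smooth (n := n) F V,
      Tendsto (fun m => ∫ x, (φ m : Smooth (n := n) (F →L[ℝ] ℝ) (Dual V)) x (s x) ∂vol) atTop
        (𝓝 (lam (trivializationAt F V x₀ ⟨x₀, s x₀⟩).2)) := by
  set t := trivializationAt F V x₀
  have hx₀ : x₀ ∈ t.baseSet := mem_baseSet_trivializationAt F V x₀
  obtain ⟨U, hU⟩ := (𝓝 x₀).exists_antitone_basis
  have hex : ∀ m, ∃ b : SmoothBumpFunction (𝓡 n) x₀, tsupport b ⊆ U m ∩ t.baseSet := fun m => by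
    obtain ⟨b, -, hb⟩ := (SmoothBumpFunction.nhds_basis_tsupport (I := 𝓡 n) x₀).mem_iff.1
      (inter_mem (hU.1.mem_of_mem (i := m) trivial) (t.open_baseSet.mem_nhds hx₀))
    exact ⟨b, hb⟩
  choose b hb using hex
  have hint : ∀ m, Integrable (b m) vol := fun m =>
    (b m).continuous.integrable_of_hasCompactSupport (b m).hasCompactSupport
  have hpos : ∀ m, 0 < ∫ x, b m x ∂vol := fun m => by
    refine (integral_pos_iff_support_of_nonneg (fun _ => (b m).nonneg) (hint m)).2 ?_
    exact (b m).isOpen_support.measure_pos vol (b m).nonempty_support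
  -- Dividing by the integral of the bump gives a Dirac sequence at `x₀`, since the supports shrink
  -- to that point.
  choose φ hφ using fun m => exists_testSection_bump (V := V) x₀ ((∫ x, b m x ∂vol)⁻¹ • lam) (b m)
    ((hb m).trans inter_subset_right)
  refine ⟨φ, fun s => ?_⟩
  set h : M → ℝ := fun x => lam (t ⟨x, s x⟩).2
  have hφ' : ∀ m x, ((φ m : Smooth (n := n) (F →L[ℝ] ℝ) (Dual V)) x) (s x) =
      (∫ x, b m x ∂vol)⁻¹ * (b m x * h x) := fun m x => by
    rw [hφ m x (s x), _root_.smul_apply, smul_eq_mul, mul_left_comm]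
  have hcont : ContinuousAt h x₀ :=
    lam.continuous.continuousAt.comp
      ((FiberBundle.continuousAt_totalSpace _ _).1 (s.contMDiff.continuous.continuousAt (x := x₀))).2
  have hbh : ∀ m, Integrable (fun x => b m x * h x) vol := fun m =>
    ((integrable_dual_apply vol (φ m) s).const_mul (∫ x, b m x ∂vol)).congr
      (ae_of_all _ fun x => by simp only [hφ', mul_inv_cancel_left₀ (hpos m).ne'])
  refine Metric.tendsto_atTop.2 fun ε hε => ?_
  obtain ⟨N, -, hN⟩ := hU.1.mem_iff.1 (hcont.eventually (Metric.ball_mem_nhds (h x₀) (half_pos hε)))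
  refine ⟨N, fun m hm => ?_⟩
  simp only [hφ']
  rw [integral_const_mul, dist_eq_norm]
  have h1 : (∫ x, b m x ∂vol)⁻¹ * ∫ x, b m x * h x ∂vol - h x₀ =
      (∫ x, b m x ∂vol)⁻¹ * ∫ x, b m x * (h x - h x₀) ∂vol := by
    simp only [mul_sub]
    rw [integral_sub (hbh m) ((hint m).mul_const _), integral_mul_const, mul_sub,
      inv_mul_cancel_left₀ (hpos m).ne']
  change ‖(∫ x, b m x ∂vol)⁻¹ * ∫ x, b m x * h x ∂vol - h x₀‖ < ε
  rw [h1, norm_mul, norm_inv, Real.norm_of_nonneg (hpos m).le, inv_mul_lt_iff₀ (hpos m)]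
  have h2 : ‖∫ x, b m x * (h x - h x₀) ∂vol‖ ≤ ∫ x, b m x * (ε / 2) ∂vol := by
    refine norm_integral_le_of_norm_le ((hint m).mul_const _) (ae_of_all _ fun x => ?_)
    rw [norm_mul, Real.norm_of_nonneg (b m).nonneg]
    by_cases hx : x ∈ tsupport (b m)
    · have := hN (hU.2 hm (hb m hx).1)
      rw [mem_ofPred_eq, dist_eq_norm] at this
      exact mul_le_mul_of_nonneg_left this.le (b m).nonneg
    · rw [image_eq_zero_of_notMem_tsupport hx, zero_mul, zero_mul]
  rw [integral_mul_const] at h2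
  have := hpos m
  nlinarith

end TestSections

/-! ### Bounded sequences as functionals on `ℓ¹` -/

section Lone

theorem summable_abs_lp_one (c : lp (fun _ : ℕ => ℝ) 1) : Summable fun ν => |c ν| := by
  simpa using (memℓp_gen_iff (p := 1) (by simp)).1 (lp.memℓp c)

theorem norm_lp_one (c : lp (fun _ : ℕ => ℝ) 1) : ‖c‖ = ∑' ν, |c ν| := by
  simp [lp.norm_eq_tsum_rpow (p := 1) (by simp) c]

theorem summable_lp_one_mul {a : ℕ → ℝ} {B : ℝ} (ha : ∀ ν, |a ν| ≤ B)
    (c : lp (fun _ : ℕ => ℝ) 1) : Summable fun ν => c ν * a ν :=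
  Summable.of_norm_bounded ((summable_abs_lp_one c).mul_right B) fun ν => by
    rw [Real.norm_eq_abs, abs_mul]
    exact mul_le_mul_of_nonneg_left (ha ν) (abs_nonneg _)

theorem abs_tsum_lp_one_mul_le {a : ℕ → ℝ} {B : ℝ} (ha : ∀ ν, |a ν| ≤ B)
    (c : lp (fun _ : ℕ => ℝ) 1) : |∑' ν, c ν * a ν| ≤ B * ‖c‖ := by
  rw [norm_lp_one, mul_comm, ← tsum_mul_right]
  exact tsum_of_norm_bounded ((summable_abs_lp_one c).mul_right B).hasSum fun ν => by
    rw [Real.norm_eq_abs, abs_mul]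
    exact mul_le_mul_of_nonneg_left (ha ν) (abs_nonneg _)

/-- A bounded sequence defines a continuous linear functional on `ℓ¹`. -/
theorem exists_clm_lp_one {a : ℕ → ℝ} {B : ℝ} (ha : ∀ ν, |a ν| ≤ B) :
    ∃ T : lp (fun _ : ℕ => ℝ) 1 →L[ℝ] ℝ, ∀ c, T c = ∑' ν, c ν * a ν := by
  refine ⟨LinearMap.mkContinuous
    { toFun := fun c => ∑' ν, c ν * a ν
      map_add' := fun c d => ?_
      map_smul' := fun r c => ?_ } B fun c => abs_tsum_lp_one_mul_le ha c, fun c => rfl⟩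
  · rw [← (summable_lp_one_mul ha c).tsum_add (summable_lp_one_mul ha d)]
    simp only [lp.coeFn_add, Pi.add_apply, add_mul]
  · simp only [lp.coeFn_smul, Pi.smul_apply, smul_eq_mul, mul_assoc, tsum_mul_left, RingHom.id_apply]

end Lone

/-! ### The distribution `∑ c_ν u_ν` -/

section Pairing

variable {n : ℕ} {M : Type*} [TopologicalSpace M] [ChartedSpace (Model n) M]
  {F : Type*} [NormedAddCommGroup F] [NormedSpace ℝ F]
  {V : M → Type*} [TopologicalSpace (TotalSpace F V)]
  [∀ x, AddCommGroup (V x)] [∀ x, Module ℝ (V x)] [∀ x, TopologicalSpace (V x)]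
  [FiberBundle F V] [VectorBundle ℝ F V]
  [∀ x, IsTopologicalAddGroup (V x)] [∀ x, ContinuousSMul ℝ (V x)]

/-- Around each point there is a compact neighbourhood on which covectors are controlled by their
expressions in the local trivialization of the dual bundle. -/
theorem exists_nhds_abs_dual_apply_le [T2Space M] (g : ContMDiffRiemannianMetric (𝓡 n) ∞ F V)
    (x₀ : M) : ∃ C > 0, ∃ N ∈ 𝓝 x₀, IsCompact N ∧
      N ⊆ (chartAt (Model n) x₀).source ∩ (trivializationAt (F →L[ℝ] ℝ) (Dual V) x₀).baseSet ∧
      ∀ x ∈ N, ∀ (ξ η : Dual V x) (v : V x), |ξ v - η v| ≤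
        C * ‖(trivializationAt (F →L[ℝ] ℝ) (Dual V) x₀ ⟨x, ξ⟩).2 -
          (trivializationAt (F →L[ℝ] ℝ) (Dual V) x₀ ⟨x, η⟩).2‖ * √(g.inner x v v) := by
  have := ChartedSpace.locallyCompactSpace (Model n) M
  obtain ⟨C, hC, hev⟩ := eventually_norm_trivializationAt_le_sqrt g x₀
  have h1 := (hev.and ((trivializationAt F V x₀).open_baseSet.mem_nhds
    (mem_baseSet_trivializationAt F V x₀))).and
      ((chartAt (Model n) x₀).open_source.mem_nhds (mem_chart_source (Model n) x₀))
  obtain ⟨N, hN, hsub, hNc⟩ := local_compact_nhds h1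
  refine ⟨C, hC, N, hN, hNc, fun x hx => ⟨(hsub hx).2,
    mem_baseSet_trivializationAt_dual (hsub hx).1.2⟩, fun x hx ξ η v => ?_⟩
  obtain ⟨⟨h2, h3⟩, -⟩ := hsub hx
  rw [dual_apply_eq h3 ξ, dual_apply_eq h3 η, ← _root_.sub_apply, ← Real.norm_eq_abs]
  refine (ContinuousLinearMap.le_opNorm _ _).trans ?_
  rw [mul_comm C, mul_assoc]
  exact mul_le_mul_of_nonneg_left (h2 v) (norm_nonneg _)

/-- On a compact set, a smooth section of the dual bundle is bounded. -/
theorem exists_abs_dual_apply_le [T2Space M] (g : ContMDiffRiemannianMetric (𝓡 n) ∞ F V)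
    (ξ : Smooth (n := n) (F →L[ℝ] ℝ) (Dual V)) {K : Set M} (hK : IsCompact K) :
    ∃ C ≥ 0, ∀ x ∈ K, ∀ v : V x, |ξ x v| ≤ C * √(g.inner x v v) := by
  refine hK.induction_on (p := fun K => ∃ C ≥ 0, ∀ x ∈ K, ∀ v : V x, |ξ x v| ≤ C * √(g.inner x v v))
    ⟨0, le_rfl, by simp⟩ (fun s t hst ⟨C, hC, h⟩ => ⟨C, hC, fun x hx => h x (hst hx)⟩) ?_ ?_
  · rintro s t ⟨C, hC, h⟩ ⟨D, hD, h'⟩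
    refine ⟨max C D, le_max_of_le_left hC, fun x hx v => ?_⟩
    rcases hx with hx | hx
    · exact (h x hx v).trans (by gcongr; exact le_max_left _ _)
    · exact (h' x hx v).trans (by gcongr; exact le_max_right _ _)
  · intro x₀ _
    obtain ⟨C, hC, N, hN, hNc, hsub, hb⟩ := exists_nhds_abs_dual_apply_le g x₀
    set t := trivializationAt (F →L[ℝ] ℝ) (Dual V) x₀
    have hcont : ContinuousOn (fun x => (t ⟨x, ξ x⟩).2) N := fun x hx => by
      have h1 : ContinuousAt (fun x => t ⟨x, ξ x⟩) x :=
        (t.continuousAt (t.mem_source.2 (hsub hx).2)).comp ξ.contMDiff.continuous.continuousAt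
      exact h1.snd.continuousWithinAt
    -- The comparison estimate is for differences of covectors, so it is used with the zero section
    -- as second covector.
    have hcont₀ : ContinuousOn (fun x => (t ⟨x, (0 : Dual V x)⟩).2) N := fun x hx => by
      have h1 : ContinuousAt (fun x => t ⟨x, (0 : Dual V x)⟩) x :=
        (t.continuousAt (t.mem_source.2 (hsub hx).2)).comp
          (0 : Smooth (n := n) (F →L[ℝ] ℝ) (Dual V)).contMDiff.continuous.continuousAt
      exact h1.snd.continuousWithinAt
    obtain ⟨D, hD⟩ := hNc.exists_bound_of_continuousOn (hcont.sub hcont₀)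
    refine ⟨N, mem_nhdsWithin_of_mem_nhds hN, C * max D 0, by positivity, fun x hx v => ?_⟩
    have h1 := hb x hx (ξ x) 0 v
    rw [_root_.zero_apply] at h1
    rw [← sub_zero (ξ x v)]
    refine h1.trans ?_
    gcongr
    exact (hD x hx).trans (le_max_left _ _)

/-- `C^∞`-convergence of sections of the dual bundle implies uniform convergence, with respect to
the fibre norm, on compact sets. -/
theorem CInftyTendsto.eventually_abs_sub_le [T2Space M] [IsManifold (𝓡 n) ∞ M]
    (g : ContMDiffRiemannianMetric (𝓡 n) ∞ F V)
    {ξ : ℕ → Smooth (n := n) (F →L[ℝ] ℝ) (Dual V)} {η : Smooth (n := n) (F →L[ℝ] ℝ) (Dual V)}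
    (h : CInftyTendsto ξ η) {K : Set M} (hK : IsCompact K) {ε : ℝ} (hε : 0 < ε) :
    ∀ᶠ ν in atTop, ∀ x ∈ K, ∀ v : V x, |ξ ν x v - η x v| ≤ ε * √(g.inner x v v) := by
  refine hK.induction_on (p := fun K => ∀ᶠ ν in atTop, ∀ x ∈ K, ∀ v : V x,
    |ξ ν x v - η x v| ≤ ε * √(g.inner x v v)) (by simp)
    (fun s t hst ht => ht.mono fun ν hν x hx => hν x (hst hx)) ?_ ?_
  · intro s t hs ht
    filter_upwards [hs, ht] with ν h1 h2 x hx
    exact hx.elim (h1 x) (h2 x)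
  · intro x₀ _
    obtain ⟨C, hC, N, hN, hNc, hsub, hb⟩ := exists_nhds_abs_dual_apply_le g x₀
    refine ⟨N, mem_nhdsWithin_of_mem_nhds hN, ?_⟩
    have h1 := Metric.tendstoUniformlyOn_iff.1
      (h _ (IsManifold.chart_mem_maximalAtlas x₀) _ N hNc hsub 0) (ε / C) (by positivity)
    filter_upwards [h1] with ν hν x hx v
    have h2 := hν _ (mem_image_of_mem _ hx)
    rw [iteratedFDeriv_zero_eq_comp, iteratedFDeriv_zero_eq_comp, Function.comp_apply,
      Function.comp_apply, LinearIsometryEquiv.dist_map, localRep_apply_of_mem _ _ (hsub hx).1,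
      localRep_apply_of_mem _ _ (hsub hx).1, dist_comm, dist_eq_norm] at h2
    refine (hb x hx (ξ ν x) (η x) v).trans ?_
    gcongr
    rw [lt_div_iff₀ hC] at h2
    linarith

/-- A locally `L¹`-bounded sequence of sections pairs boundedly with sections of the dual bundle
that vanish outside a compact set. -/
theorem LocallyL1Bounded.abs_integral_le [T2Space M] [MeasurableSpace M] [BorelSpace M]
    {vol : Measure M} {g : ContMDiffRiemannianMetric (𝓡 n) ∞ F V} {u : ℕ → Smooth (n := n) F V}
    (hbdd : LocallyL1Bounded vol g u) {K : Set M} (hK : IsCompact K) :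
    ∃ B ≥ 0, ∀ (ξ : ∀ x, Dual V x) (ε : ℝ), 0 ≤ ε → (∀ x ∉ K, ξ x = 0) →
      (∀ x ∈ K, ∀ v : V x, |ξ x v| ≤ ε * √(g.inner x v v)) →
      ∀ j, |∫ x, ξ x (u j x) ∂vol| ≤ ε * B := by
  refine ⟨_, ENNReal.toReal_nonneg (a := ⨆ j, ∫⁻ x in K,
    ENNReal.ofReal √(g.inner x (u j x) (u j x)) ∂vol), fun ξ ε hε h0 hle j => ?_⟩
  rw [← Real.norm_eq_abs, ← toReal_enorm, ← ENNReal.toReal_ofReal hε, ← ENNReal.toReal_mul]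
  refine ENNReal.toReal_mono (ENNReal.mul_ne_top ENNReal.ofReal_ne_top (hbdd K hK).ne) ?_
  calc _ ≤ ∫⁻ x, ‖ξ x (u j x)‖ₑ ∂vol := enorm_integral_le_lintegral_enorm _
    _ ≤ ∫⁻ x, K.indicator (fun x => ENNReal.ofReal ε *
        ENNReal.ofReal √(g.inner x (u j x) (u j x))) x ∂vol := by
      refine lintegral_mono fun x => ?_
      by_cases hx : x ∈ K
      · rw [indicator_of_mem hx, ← ENNReal.ofReal_mul hε, ← ofReal_norm]
        exact ENNReal.ofReal_le_ofReal (hle x hx _)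
      · simp [h0 x hx]
    _ = ENNReal.ofReal ε * ∫⁻ x in K, ENNReal.ofReal √(g.inner x (u j x) (u j x)) ∂vol := by
      rw [lintegral_indicator hK.measurableSet, lintegral_const_mul' _ _ ENNReal.ofReal_ne_top]
    _ ≤ _ := by
      gcongr
      exact le_iSup (fun j => ∫⁻ x in K, ENNReal.ofReal √(g.inner x (u j x) (u j x)) ∂vol) j

theorem LocallyL1Bounded.exists_abs_integral_le [T2Space M] [MeasurableSpace M] [BorelSpace M]
    {vol : Measure M} {g : ContMDiffRiemannianMetric (𝓡 n) ∞ F V} {u : ℕ → Smooth (n := n) F V}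
    (hbdd : LocallyL1Bounded vol g u) {Ω : TopologicalSpace.Opens M}
    (φ : TestSection (n := n) (F →L[ℝ] ℝ) (Dual V) Ω) :
    ∃ B, ∀ j, |∫ x, (φ : Smooth (n := n) (F →L[ℝ] ℝ) (Dual V)) x (u j x) ∂vol| ≤ B := by
  obtain ⟨B, -, hB⟩ := hbdd.abs_integral_le φ.2.1
  obtain ⟨C, hC, h⟩ := exists_abs_dual_apply_le g φ.1 φ.2.1
  exact ⟨C * B, hB _ C hC (fun x hx => eq_zero_of_notMem_supp hx) h⟩

/-- The functional `φ ↦ ∑ c_ν ∫ ⟨u_ν, φ⟩ vol` on test sections. -/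
noncomputable def seriesPairing [MeasurableSpace M] (vol : Measure M)
    (u : ℕ → Smooth (n := n) F V) (c : lp (fun _ : ℕ => ℝ) 1)
    (ξ : Smooth (n := n) (F →L[ℝ] ℝ) (Dual V)) : ℝ :=
  ∑' ν, c ν * ∫ x, ξ x (u ν x) ∂vol

theorem seriesPairing_smul [MeasurableSpace M] (vol : Measure M)
    (u : ℕ → Smooth (n := n) F V) (c : lp (fun _ : ℕ => ℝ) 1) (r : ℝ)
    (ξ : Smooth (n := n) (F →L[ℝ] ℝ) (Dual V)) :
    seriesPairing vol u c (r • ξ) = r * seriesPairing vol u c ξ := by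
  rw [seriesPairing, seriesPairing, ← tsum_mul_left]
  refine tsum_congr fun ν => ?_
  rw [mul_left_comm]
  exact congrArg (c ν * ·) (integral_const_mul r fun x => ξ x (u ν x))

variable [T2Space M] [MeasurableSpace M] [BorelSpace M] {vol : Measure M}
  [IsFiniteMeasureOnCompacts vol] {g : ContMDiffRiemannianMetric (𝓡 n) ∞ F V}
  {u : ℕ → Smooth (n := n) F V}

theorem LocallyL1Bounded.seriesPairing_add (hbdd : LocallyL1Bounded vol g u)
    (c : lp (fun _ : ℕ => ℝ) 1) {Ω : TopologicalSpace.Opens M}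
    (φ ψ : TestSection (n := n) (F →L[ℝ] ℝ) (Dual V) Ω) :
    seriesPairing vol u c (φ.1 + ψ.1) = seriesPairing vol u c φ.1 + seriesPairing vol u c ψ.1 := by
  obtain ⟨B, hB⟩ := hbdd.exists_abs_integral_le φ
  obtain ⟨B', hB'⟩ := hbdd.exists_abs_integral_le ψ
  rw [seriesPairing, seriesPairing, seriesPairing,
    ← (summable_lp_one_mul hB c).tsum_add (summable_lp_one_mul hB' c)]
  refine tsum_congr fun ν => ?_
  rw [← mul_add]
  exact congrArg (c ν * ·) (integral_add (integrable_dual_apply vol φ (u ν))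
    (integrable_dual_apply vol ψ (u ν)))

/-- All supports lie in one compact set, where `φ m - φ₀` is uniformly small in the dual fibre norm.
The `L¹` bound makes its pairings with the `u ν` small uniformly in `ν`, and summability of `c`
preserves this. -/
theorem LocallyL1Bounded.tendsto_seriesPairing [IsManifold (𝓡 n) ∞ M]
    (hbdd : LocallyL1Bounded vol g u)
    (c : lp (fun _ : ℕ => ℝ) 1) {Ω : TopologicalSpace.Opens M}
    {φ : ℕ → TestSection (n := n) (F →L[ℝ] ℝ) (Dual V) Ω}
    {φ₀ : TestSection (n := n) (F →L[ℝ] ℝ) (Dual V) Ω} (h : TestTendsto φ φ₀) :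
    Tendsto (fun m => seriesPairing vol u c (φ m).1) atTop (𝓝 (seriesPairing vol u c φ₀.1)) := by
  obtain ⟨⟨K, hK, -, hsupp⟩, hconv⟩ := h
  have hK' := hK.union φ₀.2.1
  obtain ⟨B, hB0, hB⟩ := hbdd.abs_integral_le hK'
  refine Metric.tendsto_atTop.2 fun ε hε => ?_
  -- The summand `1` keeps the denominator positive when `B * ‖c‖ = 0` and makes the final
  -- inequality strict.
  have hδ : 0 < ε / (B * ‖c‖ + 1) := by positivity
  obtain ⟨N, hN⟩ := eventually_atTop.1 (hconv.eventually_abs_sub_le g hK' hδ)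
  refine ⟨N, fun m hm => ?_⟩
  obtain ⟨B₁, hB₁⟩ := hbdd.exists_abs_integral_le (φ m)
  obtain ⟨B₂, hB₂⟩ := hbdd.exists_abs_integral_le φ₀
  rw [Real.dist_eq, seriesPairing, seriesPairing,
    ← (summable_lp_one_mul hB₁ c).tsum_sub (summable_lp_one_mul hB₂ c)]
  have hsub : ∀ ν, c ν * ∫ x, (φ m).1 x (u ν x) ∂vol - c ν * ∫ x, φ₀.1 x (u ν x) ∂vol =
      c ν * ∫ x, ((φ m).1 x - φ₀.1 x) (u ν x) ∂vol := fun ν => by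
    rw [← mul_sub]
    exact congrArg (c ν * ·) (integral_sub (integrable_dual_apply vol (φ m) (u ν))
      (integrable_dual_apply vol φ₀ (u ν))).symm
  rw [tsum_congr hsub]
  refine (abs_tsum_lp_one_mul_le (B := ε / (B * ‖c‖ + 1) * B) (hB _ _ hδ.le (fun x hx => ?_)
    fun x hx v => hN m hm x hx v) c).trans_lt ?_
  · rw [eq_zero_of_notMem_supp fun h => hx (Or.inl (hsupp m h)),
      eq_zero_of_notMem_supp fun h => hx (Or.inr h), sub_zero]
  · rw [mul_assoc, div_mul_eq_mul_div, div_lt_iff₀ (by positivity)]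
    nlinarith

/-- The distribution `∑ c_ν u_ν`, for `c ∈ ℓ¹` and a locally `L¹`-bounded sequence `u`. -/
noncomputable def LocallyL1Bounded.distSection [IsManifold (𝓡 n) ∞ M]
    (hbdd : LocallyL1Bounded vol g u) (Ω : TopologicalSpace.Opens M)
    (c : lp (fun _ : ℕ => ℝ) 1) : DistSection n F V Ω where
  toLin :=
    { toFun := fun φ => seriesPairing vol u c φ.1
      map_add' := hbdd.seriesPairing_add c
      map_smul' := fun r φ => seriesPairing_smul vol u c r φ.1 }
  continuous' := fun _ _ h => hbdd.tendsto_seriesPairing c h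

end Pairing

/-! ### A priori estimates for solutions -/

section Solutions

variable {n : ℕ} {M : Type*} [TopologicalSpace M] [ChartedSpace (Model n) M]
  {F : Type*} [NormedAddCommGroup F] [NormedSpace ℝ F]
  {V : M → Type*} [TopologicalSpace (TotalSpace F V)]
  [∀ x, AddCommGroup (V x)] [∀ x, Module ℝ (V x)] [∀ x, TopologicalSpace (V x)]
  [FiberBundle F V] [VectorBundle ℝ F V]

/-- Two local trivializations differ, in a fibre, by a continuous linear map. -/
theorem exists_clm_trivialization_eq
    (t t' : Trivialization F (TotalSpace.proj : TotalSpace F V → M)) [MemTrivializationAtlas t]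
    [MemTrivializationAtlas t'] {x : M} (hx : x ∈ t.baseSet) (hx' : x ∈ t'.baseSet) :
    ∃ A : F →L[ℝ] F, ∀ v : V x, (t ⟨x, v⟩).2 = A (t' ⟨x, v⟩).2 := by
  refine ⟨(t.continuousLinearMapAt ℝ x).comp (t'.symmL ℝ x), fun v => ?_⟩
  rw [ContinuousLinearMap.comp_apply, t'.symmL_apply hx', t'.symm_apply_apply_mk hx',
    t.continuousLinearMapAt_apply ℝ, t.coe_linearMapAt_of_mem hx]

theorem trivialization_snd_injective
    (t : Trivialization F (TotalSpace.proj : TotalSpace F V → M)) {x : M}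
    (hx : x ∈ t.baseSet) {v w : V x} (h : (t ⟨x, v⟩).2 = (t ⟨x, w⟩).2) : v = w := by
  rw [← t.symm_apply_apply_mk hx v, h, t.symm_apply_apply_mk hx w]

variable {G : Type*} [NormedAddCommGroup G] [NormedSpace ℝ G]
  {W : M → Type*} [TopologicalSpace (TotalSpace G W)]
  [∀ x, AddCommGroup (W x)] [∀ x, Module ℝ (W x)] [∀ x, TopologicalSpace (W x)]
  [FiberBundle G W] [VectorBundle ℝ G W]
  [∀ x, IsTopologicalAddGroup (V x)] [∀ x, ContinuousSMul ℝ (V x)]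
  [T2Space M] [MeasurableSpace M] [BorelSpace M] [IsManifold (𝓡 n) ∞ M] {vol : Measure M}
  [IsFiniteMeasureOnCompacts vol] {g : ContMDiffRiemannianMetric (𝓡 n) ∞ F V}
  {u : ℕ → Smooth (n := n) F V}

/-- For a weakly hypoelliptic operator, `ℓ¹`-combinations of locally `L¹`-bounded solutions are
smooth. -/
theorem IsWeaklyHypoelliptic.exists_smooth_series
    {L : Smooth (n := n) F V →ₗ[ℝ] Smooth (n := n) G W} (hypo : IsWeaklyHypoelliptic vol L)
    (hu : ∀ j, L (u j) = 0) (hbdd : LocallyL1Bounded vol g u) (c : lp (fun _ : ℕ => ℝ) 1) :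
    ∃ s : Smooth (n := n) F V, ∀ φ : TestSection (n := n) (F →L[ℝ] ℝ) (Dual V) ⊤,
      seriesPairing vol u c φ.1 = ∫ x, φ.1 x (s x) ∂vol := by
  -- Hypoellipticity is applied over all of `M`. The series solves the equation term by term, since
  -- pairing `u ν` with `ψ = L* φ` equals pairing `L (u ν) = 0` with `φ`.
  obtain ⟨s, hs, h⟩ := hypo ⊤ (hbdd.distSection ⊤ c) fun φ ψ hφψ => by
    change ∑' ν, c ν * ∫ x, ψ.1 x (u ν x) ∂vol = 0
    have h0 : ∀ ν, ∫ x, ψ.1 x (u ν x) ∂vol = 0 := fun ν => by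
      rw [← hφψ (u ν), hu ν]
      simp
    simp [h0]
  exact ⟨⟨s, contMDiffOn_univ.1 hs⟩, h⟩

variable [SecondCountableTopology M] [ContMDiffVectorBundle ∞ F V (𝓡 n)] [vol.IsOpenPosMeasure]
  [FiniteDimensional ℝ F]

/-- The values of `∑ c_ν u_ν` depend continuously and linearly on `c ∈ ℓ¹`. -/
theorem LocallyL1Bounded.exists_clm_series (hbdd : LocallyL1Bounded vol g u)
    {s : lp (fun _ : ℕ => ℝ) 1 → Smooth (n := n) F V}
    (hs : ∀ c, ∀ φ : TestSection (n := n) (F →L[ℝ] ℝ) (Dual V) ⊤,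
      seriesPairing vol u c φ.1 = ∫ x, φ.1 x (s c x) ∂vol)
    (t : Trivialization F (TotalSpace.proj : TotalSpace F V → M)) [MemTrivializationAtlas t]
    {x : M} (hx : x ∈ t.baseSet) :
    ∃ T : lp (fun _ : ℕ => ℝ) 1 →L[ℝ] F, ∀ c, T c = (t ⟨x, s c x⟩).2 := by
  -- For each test section of a Dirac sequence, the pairing with `s c` is a continuous functional of
  -- `c`, because the pairings with the `u ν` are bounded. The pointwise limit in `m` stays
  -- continuous.
  have hlam : ∀ lam : F →L[ℝ] ℝ, ∃ T : lp (fun _ : ℕ => ℝ) 1 →L[ℝ] ℝ,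
      ∀ c, T c = lam (trivializationAt F V x ⟨x, s c x⟩).2 := fun lam => by
    obtain ⟨φ, hφ⟩ := exists_testSection_tendsto (n := n) (V := V) vol x lam
    choose B hB using fun m => hbdd.exists_abs_integral_le (φ m)
    choose T hT using fun m => exists_clm_lp_one (hB m)
    refine exists_clm_of_tendsto (T := T) fun c => (hφ (s c)).congr fun m => ?_
    rw [hT, ← hs c (φ m)]
    rfl
  choose T hT using fun i => hlam ((Module.finBasis ℝ F).coord i).toContinuousLinearMap
  obtain ⟨A, hA⟩ := exists_clm_trivialization_eq t (trivializationAt F V x) hx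
    (mem_baseSet_trivializationAt F V x)
  refine ⟨A.comp (∑ i, (T i).smulRight (Module.finBasis ℝ F i)), fun c => ?_⟩
  rw [hA, ContinuousLinearMap.comp_apply]
  congr 1
  rw [_root_.sum_apply]
  simp only [ContinuousLinearMap.smulRight_apply, hT]
  exact (Module.finBasis ℝ F).sum_repr _

/-- A Dirac sequence recovers every coordinate of a smooth section from its pairings, and for a unit
vector of `ℓ¹` the series has a single term. -/
theorem series_single
    {s : lp (fun _ : ℕ => ℝ) 1 → Smooth (n := n) F V}
    (hs : ∀ c, ∀ φ : TestSection (n := n) (F →L[ℝ] ℝ) (Dual V) ⊤,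
      seriesPairing vol u c φ.1 = ∫ x, φ.1 x (s c x) ∂vol) (ν : ℕ) (x : M) :
    s (lp.single 1 ν 1) x = u ν x := by
  refine trivialization_snd_injective _ (mem_baseSet_trivializationAt F V x)
    ((Module.finBasis ℝ F).ext_elem fun i => ?_)
  set lam := ((Module.finBasis ℝ F).coord i).toContinuousLinearMap
  obtain ⟨φ, hφ⟩ := exists_testSection_tendsto (n := n) (V := V) vol x lam
  refine tendsto_nhds_unique (hφ (s (lp.single 1 ν 1))) ((hφ (u ν)).congr fun m => ?_)
  rw [← hs _ (φ m), seriesPairing, tsum_eq_single ν fun μ hμ => ?_]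
  · simp
  · simp [hμ]

/-- Locally `L¹`-bounded sequences of solutions are locally bounded with all derivatives. -/
theorem IsWeaklyHypoelliptic.exists_norm_iteratedFDeriv_le
    {L : Smooth (n := n) F V →ₗ[ℝ] Smooth (n := n) G W} (hypo : IsWeaklyHypoelliptic vol L)
    (hu : ∀ j, L (u j) = 0) (hbdd : LocallyL1Bounded vol g u)
    {e : OpenPartialHomeomorph M (Model n)} (he : e ∈ IsManifold.maximalAtlas (𝓡 n) ∞ M)
    (t : Trivialization F (TotalSpace.proj : TotalSpace F V → M)) [MemTrivializationAtlas t]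
    (j : ℕ) (K : Set (Model n)) (hK : K ⊆ e '' (e.source ∩ t.baseSet)) (hKc : IsCompact K) :
    ∃ C, ∀ ν, ∀ y ∈ K, ‖iteratedFDeriv ℝ j (localRep e t (u ν)) y‖ ≤ C := by
  -- The sections `s c` are chosen separately for each `c`; linearity and continuity in `c` come
  -- from `LocallyL1Bounded.exists_clm_series`.
  choose s hs using hypo.exists_smooth_series hu hbdd
  obtain ⟨C, hC⟩ := Montel.exists_norm_iteratedFDeriv_le
    (isOpen_image_source_inter_baseSet e t) (fun c => contDiffOn_localRep he t (s c))
    (by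
      rintro _ ⟨x, hx, rfl⟩
      simp only [localRep_apply_of_mem t _ hx.1]
      exact hbdd.exists_clm_series hs t hx.2) j hKc hK
  refine ⟨C, fun ν y hy => ?_⟩
  have h1 := hC (lp.single 1 ν 1) y hy
  have h2 : localRep e t (s (lp.single 1 ν 1)) = localRep e t (u ν) := by
    ext1 y
    simp only [localRep, series_single hs]
  rwa [h2, lp.norm_single (by simp), norm_one, mul_one] at h1

end Solutions

/-! ### Extraction of a subsequence and passage to the limit -/

section Subsequences

variable {n : ℕ} {M : Type*} [TopologicalSpace M] [ChartedSpace (Model n) M]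
  [SecondCountableTopology M] [IsManifold (𝓡 n) ∞ M]
  {F : Type*} [NormedAddCommGroup F] [NormedSpace ℝ F] [FiniteDimensional ℝ F]
  {V : M → Type*} [TopologicalSpace (TotalSpace F V)]
  [∀ x, AddCommGroup (V x)] [∀ x, Module ℝ (V x)] [∀ x, TopologicalSpace (V x)]
  [FiberBundle F V] [VectorBundle ℝ F V] [ContMDiffVectorBundle ∞ F V (𝓡 n)]

/-- Arzelà–Ascoli: a sequence of sections that is locally bounded with all its derivatives has a
subsequence converging in the `C^∞`-topology. -/
theorem exists_subseq_cInftyTendsto {u : ℕ → Smooth (n := n) F V}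
    (hbdd : ∀ e ∈ IsManifold.maximalAtlas (𝓡 n) ∞ M,
      ∀ (t : Trivialization F (TotalSpace.proj : TotalSpace F V → M)) [MemTrivializationAtlas t]
      (j : ℕ) (K : Set (Model n)), K ⊆ e '' (e.source ∩ t.baseSet) → IsCompact K →
      ∃ C, ∀ ν, ∀ y ∈ K, ‖iteratedFDeriv ℝ j (localRep e t (u ν)) y‖ ≤ C) :
    ∃ σ : ℕ → ℕ, StrictMono σ ∧ ∃ w : Smooth (n := n) F V,
      CInftyTendsto (fun j => u (σ j)) w := by
  obtain ⟨D, hDc, hDd⟩ := TopologicalSpace.exists_countable_dense M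
  have : Countable D := hDc.to_subtype
  have hpt : ∀ x : M, ∃ C, ∀ ν, ‖(trivializationAt F V x ⟨x, u ν x⟩).2‖ ≤ C := fun x => by
    have hxe := mem_chart_source (Model n) x
    obtain ⟨C, hC⟩ := hbdd _ (IsManifold.chart_mem_maximalAtlas x) (trivializationAt F V x) 0
      {chartAt (Model n) x x}
      (singleton_subset_iff.2 ⟨x, ⟨hxe, mem_baseSet_trivializationAt F V x⟩, rfl⟩)
      isCompact_singleton
    refine ⟨C, fun ν => ?_⟩
    have := hC ν _ rfl
    rwa [norm_iteratedFDeriv_zero, localRep_apply_of_mem _ _ hxe] at this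
  choose C hC using hpt
  -- Tychonoff replaces a diagonal argument: a product of closed balls over the countable set `D` is
  -- compact and metrizable, hence sequentially compact.
  obtain ⟨l, -, σ, hσ, hl⟩ := (isCompact_univ_pi fun d : D =>
    isCompact_closedBall (0 : F) (C d)).tendsto_subseq
      (x := fun ν (d : D) => (trivializationAt F V (d : M) ⟨d, u ν d⟩).2)
      fun ν d _ => by simpa using hC d ν
  refine ⟨σ, hσ, ?_⟩
  have hbσ : ∀ e ∈ IsManifold.maximalAtlas (𝓡 n) ∞ M,
      ∀ (t : Trivialization F (TotalSpace.proj : TotalSpace F V → M)) [MemTrivializationAtlas t]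
      (j : ℕ) (K : Set (Model n)), K ⊆ e '' (e.source ∩ t.baseSet) → IsCompact K →
      ∃ C, ∀ ν, ∀ y ∈ K, ‖iteratedFDeriv ℝ j (localRep e t (u (σ ν))) y‖ ≤ C :=
    fun e he t _ j K hK hKc => (hbdd e he t j K hK hKc).imp fun C h ν => h (σ ν)
  have hlim : ∀ x : M, ∃ a, Tendsto (fun ν => (trivializationAt F V x ⟨x, u (σ ν) x⟩).2) atTop
      (𝓝 a) := fun x => by
    set e := chartAt (Model n) x
    set t := trivializationAt F V x
    have he : e ∈ IsManifold.maximalAtlas (𝓡 n) ∞ M := IsManifold.chart_mem_maximalAtlas x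
    have hxe : x ∈ e.source := mem_chart_source (Model n) x
    have hxt : x ∈ t.baseSet := mem_baseSet_trivializationAt F V x
    have hO := isOpen_image_source_inter_baseSet e t
    have hcau := locallyUniformCauchy_iteratedFDeriv (D := e '' (D ∩ (e.source ∩ t.baseSet))) hO
      (fun ν => contDiffOn_localRep he t (u (σ ν))) (hbσ e he t) (by
        rintro _ ⟨z, hz, rfl⟩
        refine mem_closure_iff.2 fun N hN hzN => ?_
        obtain ⟨d, ⟨⟨hd1, hd2⟩, hd3⟩, hdD⟩ := hDd.inter_open_nonempty _
          ((e.isOpen_inter_preimage hN).inter t.open_baseSet) ⟨z, ⟨hz.1, hzN⟩, hz.2⟩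
        exact ⟨e d, hd2, mem_image_of_mem _ ⟨hdD, hd1, hd3⟩⟩) (by
        rintro _ ⟨⟨d, ⟨hdD, hd1, hd2⟩, rfl⟩, -⟩
        -- Convergence at `d` is known in the trivialization chosen at `d`; a fibrewise linear map
        -- transfers it to the one at `x`.
        obtain ⟨A, hA⟩ := exists_clm_trivialization_eq t (trivializationAt F V d) hd2
          (mem_baseSet_trivializationAt F V d)
        simp only [localRep_apply_of_mem t _ hd1, hA]
        exact ((A.continuous.tendsto _).comp
          ((tendsto_pi_nhds.1 hl) ⟨d, hdD⟩)).cauchySeq) 0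
    obtain ⟨r, hr, h⟩ := hcau (e x) (mem_image_of_mem _ ⟨hxe, hxt⟩)
    have h1 := ((continuousMultilinearCurryFin0 ℝ (Model n)
      F).isometry.uniformContinuous.comp_cauchySeq (h.cauchy_map (Metric.mem_ball_self hr)))
    refine cauchySeq_tendsto_of_complete ?_
    simpa [Function.comp_def, localRep_apply_of_mem t _ hxe] using h1
  choose a ha using hlim
  let w : ∀ x, V x := fun x => (trivializationAt F V x).symm x (a x)
  have hw : ∀ (t : Trivialization F (TotalSpace.proj : TotalSpace F V → M))
      [MemTrivializationAtlas t] (x : M), x ∈ t.baseSet →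
      Tendsto (fun ν => (t ⟨x, u (σ ν) x⟩).2) atTop (𝓝 (t ⟨x, w x⟩).2) := fun t _ x hx => by
    have hx₀ := mem_baseSet_trivializationAt F V x
    obtain ⟨A, hA⟩ := exists_clm_trivialization_eq t (trivializationAt F V x) hx hx₀
    simp only [hA, w, (trivializationAt F V x).apply_mk_symm hx₀]
    exact (A.continuous.tendsto _).comp (ha x)
  have key : ∀ e ∈ IsManifold.maximalAtlas (𝓡 n) ∞ M,
      ∀ (t : Trivialization F (TotalSpace.proj : TotalSpace F V → M)) [MemTrivializationAtlas t],
      _ := fun e he t _ =>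
    contDiffOn_and_tendsto_of_bounded (g := localRep e t w) (isOpen_image_source_inter_baseSet e t)
      (fun ν => contDiffOn_localRep he t (u (σ ν))) (hbσ e he t) (by
        rintro _ ⟨x, hx, rfl⟩
        simp only [localRep_apply_of_mem t _ hx.1]
        exact hw t x hx.2)
  refine ⟨⟨w, contMDiff_of_contDiffOn_localRep w fun x₀ =>
    (key _ (IsManifold.chart_mem_maximalAtlas x₀) (trivializationAt F V x₀)).1⟩,
    fun e he t _ K hK hKs j => (key e he t).2 j _ (image_mono hKs)
      (hK.image_of_continuousOn (e.continuousOn.mono (hKs.trans inter_subset_left)))⟩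

variable {G : Type*} [NormedAddCommGroup G] [NormedSpace ℝ G]
  {W : M → Type*} [TopologicalSpace (TotalSpace G W)]
  [∀ x, AddCommGroup (W x)] [∀ x, Module ℝ (W x)] [∀ x, TopologicalSpace (W x)]
  [FiberBundle G W] [VectorBundle ℝ G W]

/-- The kernel of a differential operator is sequentially closed in the `C^∞`-topology. -/
theorem IsDifferentialOperator.map_eq_zero_of_tendsto {k : ℕ}
    {L : Smooth (n := n) F V →ₗ[ℝ] Smooth (n := n) G W} (hL : IsDifferentialOperator k L)
    {u : ℕ → Smooth (n := n) F V} (hu : ∀ j, L (u j) = 0) {w : Smooth (n := n) F V}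
    (hw : CInftyTendsto u w) : L w = 0 := by
  ext x
  obtain ⟨a, -, ha⟩ := hL x
  set e := chartAt (Model n) x
  set t := trivializationAt F V x
  set t' := trivializationAt G W x
  have hxe : x ∈ e.source := mem_chart_source (Model n) x
  have hxt : x ∈ t.baseSet := mem_baseSet_trivializationAt F V x
  have hxt' : x ∈ t'.baseSet := mem_baseSet_trivializationAt G W x
  have hy : e x ∈ e '' (e.source ∩ t.baseSet ∩ t'.baseSet) :=
    mem_image_of_mem _ ⟨⟨hxe, hxt⟩, hxt'⟩
  refine trivialization_snd_injective t' hxt' ?_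
  rw [← localRep_apply_of_mem t' _ hxe, ← localRep_apply_of_mem t' (fun x => (0 : Smooth (n := n) G W) x) hxe]
  refine tendsto_nhds_unique (f := fun ν => localRep e t' (L (u ν)) (e x)) (l := atTop) ?_ ?_
  · simp only [ha _ _ hy]
    refine tendsto_finsetSum _ fun j _ => ((a j (e x)).continuous.tendsto _).comp ?_
    exact (hw e (IsManifold.chart_mem_maximalAtlas x) t {x} isCompact_singleton
      (singleton_subset_iff.2 ⟨hxe, hxt⟩) j).tendsto_at (mem_image_of_mem _ rfl)
  · simp only [hu]
    exact tendsto_const_nhds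

end Subsequences

end Montel

/-! ### The generalized Montel theorem -/

theorem theorem3p1 {n : ℕ}
    {M : Type*} [TopologicalSpace M] [T2Space M] [SecondCountableTopology M]
    [ChartedSpace (Montel.Model n) M] [IsManifold (𝓡 n) ∞ M]
    [MeasurableSpace M] [BorelSpace M]
    (vol : Measure M) (hvol : Montel.IsSmoothPositiveDensity n vol)
    {F : Type*} [NormedAddCommGroup F] [NormedSpace ℝ F] [FiniteDimensional ℝ F]
    {V : M → Type*} [TopologicalSpace (TotalSpace F V)]
    [∀ x, AddCommGroup (V x)] [∀ x, Module ℝ (V x)] [∀ x, TopologicalSpace (V x)]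
    [∀ x, IsTopologicalAddGroup (V x)] [∀ x, ContinuousSMul ℝ (V x)]
    [FiberBundle F V] [VectorBundle ℝ F V] [ContMDiffVectorBundle ∞ F V (𝓡 n)]
    {G : Type*} [NormedAddCommGroup G] [NormedSpace ℝ G] [FiniteDimensional ℝ G]
    {W : M → Type*} [TopologicalSpace (TotalSpace G W)]
    [∀ x, AddCommGroup (W x)] [∀ x, Module ℝ (W x)] [∀ x, TopologicalSpace (W x)]
    [∀ x, IsTopologicalAddGroup (W x)] [∀ x, ContinuousSMul ℝ (W x)]
    [FiberBundle G W] [VectorBundle ℝ G W] [ContMDiffVectorBundle ∞ G W (𝓡 n)]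
    (g : ContMDiffRiemannianMetric (𝓡 n) ∞ F V)
    (k : ℕ) (L : Montel.Smooth (n := n) F V →ₗ[ℝ] Montel.Smooth (n := n) G W)
    (hL : Montel.IsDifferentialOperator k L)
    (hypo : Montel.IsWeaklyHypoelliptic vol L)
    (u : ℕ → Montel.Smooth (n := n) F V) (hu : ∀ j, L (u j) = 0)
    (hbdd : Montel.LocallyL1Bounded vol g u) :
    ∃ σ : ℕ → ℕ, StrictMono σ ∧
      ∃ w : Montel.Smooth (n := n) F V, L w = 0 ∧ Montel.CInftyTendsto (fun j => u (σ j)) w := by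
  have := hvol.isLocallyFiniteMeasure
  have := hvol.isOpenPosMeasure
  obtain ⟨σ, hσ, w, hw⟩ := Montel.exists_subseq_cInftyTendsto fun e he t _ j K hK hKc =>
    hypo.exists_norm_iteratedFDeriv_le hu hbdd he t j K hK hKc
  exact ⟨σ, hσ, w, hL.map_eq_zero_of_tendsto (fun j => hu (σ j)) hw, hw⟩
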